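/- **Setting.** Let $\mathcal H_A,\mathcal H_B$ be separable complex Hilbert spaces, possibly infinite-dimensional, with fixed orthonormal bases labelled by countable sets $I,J$; so $\mathcal H_A=\ell^2(I)$, $\mathcal H_B=\ell^2(J)$, $\mathcal H_{AB}=\ell^2(I\times J)$. A state is a positive trace class operator of trace $1$. For a bounded operator $X$ on $\mathcal H_{AB}$, $X^\Gamma$ is the partial transpose, $\langle ij|X^\Gamma|i'j'\rangle=\langle ij'|X|i'j\rangle$; a condition on $X^\Gamma$ (such as $\|X^\Gamma\|_\infty\le 1$ or $X^\Gamma\ge 0$) includes that it is a bounded operator. Let $\mathcal S$ be the cone generated by the separable states (the trace norm closure of the convex hull of the pure product states), let $\mathcal{PPT}$ be the cone of positive trace class operators $T$ with $T^\Gamma\ge0$, and let $\mathcal K$ be one of these two cones (defined for every bipartite system). * A $\mathcal K$-preserving operation $\Lambda\in\mathrm{KP}(AB\to A'B')$ is a positive (not necessarily completely positive), trace preserving linear map from the trace class operators on $AB$ to those on $A'B'$ with $\Lambda(\mathcal K_{AB})\subseteq\mathcal K_{A'B'}$. * $\Phi_2$ is the projector onto $(|00\rangle+|11\rangle)/\sqrt2$,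 in the two-qubit system $A_0B_0$. For $\epsilon\in[0,1)$, with $\inf\emptyset=+\infty$, $$E^{\epsilon}_{c,\mathrm{KP}}(\rho)=\inf\Big\{R>0:\ \limsup_{n\to\infty}\ \inf_{\Lambda_n\in \mathrm{KP}(A_0^{\lfloor Rn\rfloor}B_0^{\lfloor Rn\rfloor}\to A^nB^n)}\tfrac12\big\|\Lambda_n(\Phi_2^{\otimes\lfloor Rn\rfloor})-\rho^{\otimes n}\big\|_1\le\epsilon\Big\}.$$ $E_{c,\mathrm{LOCC}}(\rho)$ is defined in the same way, with $\epsilon=0$ and with $\mathrm{KP}$ replaced by the set of LOCC operations (finitely many rounds of local measurements with countably many outcomes, each outcome being communicated to the other party). * $[-\mathbb 1,\mathbb 1]_{\mathcal K^*}$ is the set of self-adjoint bounded $X$ with $|\mathrm{Tr}\,XW|\le \mathrm{Tr}\,W$ for all $W\in\mathcal K$. The tempered robustness $R^\tau_{\mathcal K}$ and the tempered logarithmic negativity $E^\tau_N$ are given by $$1+2R^\tau_{\mathcal K}(\rho)=\sup\{\mathrm{Tr}\,X\rho:\ X\in[-\mathbb 1,\mathbb 1]_{\mathcal K^*},\ \|X\|_\infty=\mathrm{Tr}\,X\rho\},$$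 $$N_\tau(\rho)=\sup\{\mathrm{Tr}\,X\rho:\ X=X^\dagger,\ \|X^\Gamma\|_\infty\le1,\ \|X\|_\infty=\mathrm{Tr}\,X\rho\},\qquad E^\tau_N(\rho)=\log_2N_\tau(\rho).$$ **Theorem.** For $\mathcal K=\mathcal S$ and for $\mathcal K=\mathcal{PPT}$, and for every state $\rho$ on $\mathcal H_{AB}$, the following inequalities hold in $[-\infty,+\infty]$: $$\inf_{\epsilon\in[0,1/2)}E^{\epsilon}_{c,\mathrm{KP}}(\rho)\ \ge\ L^\tau_{\mathcal K}(\rho):=\limsup_{n\to\infty}\frac1n\log_2\big(1+R^\tau_{\mathcal K}(\rho^{\otimes n})\big)\ \ge\ E^\tau_N(\rho).$$ Moreover $E_{c,\mathrm{LOCC}}(\rho)\ge E^\tau_N(\rho)$. The bound $E^\tau_N(\rho)=\log_2 N_\tau(\rho)$ is single-letter and given by a semi-definite program: $$N_\tau(\rho)=\sup\{\mathrm{Tr}\,X\rho:\ X=X^\dagger,\ -\mathbb 1\le X^\Gamma\le\mathbb 1,\ -(\mathrm{Tr}\,X\rho)\mathbb 1\le X\le(\mathrm{Tr}\,X\rho)\mathbb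 1\}.$$ -/

import Mathlib

open scoped ENNReal
open Filter Topology

namespace Ent

noncomputable section

/-! ### Separable Hilbert spaces, trace class operators, states

A separable Hilbert space with a fixed orthonormal basis labelled by the countable set `ι` is
`ℓ²(ι)`; the Hilbert space tensor product of `ℓ²(a)` and `ℓ²(b)` is `ℓ²(a × b)`. -/

/-- The Hilbert space `ℓ²(ι)` of square-summable complex families. -/
abbrev L2 (ι : Type) : Type := lp (fun _ : ι => ℂ) 2

/-- Bounded operators on `ℓ²(ι)`. -/
abbrev Op (ι : Type) : Type := L2 ι →L[ℂ] L2 ι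

open Classical in
/-- The basis vector `|i⟩` of `ℓ²(ι)`. -/
def ket {ι : Type} (i : ι) : L2 ι := lp.single 2 i (1 : ℂ)

/-- The matrix element `⟨i|T|j⟩`. -/
def entry {ι κ : Type} (T : L2 κ →L[ℂ] L2 ι) (i : ι) (j : κ) : ℂ := inner ℂ (ket i) (T (ket j))

/-- The trace `Tr T = ∑ᵢ ⟨i|T|i⟩` (an absolutely convergent series if `T` is of trace class). -/
def trace {ι : Type} (T : Op ι) : ℂ := ∑' i, entry T i i

/-- The absolute value `|T| = √(T†T)` of a bounded operator. -/
def opAbs {H : Type*} [NormedAddCommGroup H] [InnerProductSpace ℂ H] [CompleteSpace H]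
    (T : H →L[ℂ] H) : H →L[ℂ] H := CFC.abs T

/-- The trace norm `‖T‖₁ = ∑ᵢ ⟨i| √(T†T) |i⟩ ∈ [0, ∞]`. -/
def traceNorm {ι : Type} (T : Op ι) : ℝ≥0∞ := ∑' i, ENNReal.ofReal (entry (opAbs T) i i).re

/-- `T` is of trace class. -/
def IsTraceClass {ι : Type} (T : Op ι) : Prop := traceNorm T < ∞

/-- Density operators. -/
structure IsState {ι : Type} (ρ : Op ι) : Prop where
  nonneg : 0 ≤ ρ
  traceClass : IsTraceClass ρ
  trace_eq_one : trace ρ = 1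

/-- The rank-one operator `|ψ⟩⟨ψ|`. -/
def proj {ι : Type} (ψ : L2 ι) : Op ι := InnerProductSpace.rankOne ℂ ψ ψ

/-! ### Tensor products -/

theorem summable_sq {ι : Type} (f : L2 ι) : Summable fun i => ‖f i‖ ^ 2 := by
  simpa using (lp.memℓp f).summable (by norm_num)

theorem memℓp_of_sq {ι : Type} {f : ι → ℂ} (h : Summable fun i => ‖f i‖ ^ 2) :
    Memℓp f 2 := memℓp_gen (by simpa using h)

theorem norm_sq_eq {ι : Type} (f : L2 ι) : ‖f‖ ^ 2 = ∑' i, ‖f i‖ ^ 2 := by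
  simpa using lp.norm_rpow_eq_tsum (p := 2) (by norm_num) f

theorem inner_ket {ι : Type} (i : ι) (f : L2 ι) : inner ℂ (ket i) f = f i := by
  classical
  rw [ket]
  convert lp.inner_single_left (𝕜 := ℂ) (G := fun _ : ι => ℂ) i (1 : ℂ) f using 1
  simp

/-- The product vector `ψ ⊗ φ`. -/
def tensorVec {a b : Type} (ψ : L2 a) (φ : L2 b) : L2 (a × b) :=
  ⟨fun p => ψ p.1 * φ p.2, memℓp_of_sq (by
    simpa [mul_pow] using (summable_sq ψ).mul_of_nonneg (summable_sq φ)
      (fun _ => by positivity) (fun _ => by positivity))⟩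

/-- Relabelling of the basis along a bijection, as a unitary operator. -/
def reindex {ι κ : Type} (e : ι ≃ κ) : L2 ι ≃ₗᵢ[ℂ] L2 κ where
  toFun f := ⟨fun k => f (e.symm k), memℓp_of_sq (e.symm.summable_iff.2 (summable_sq f))⟩
  invFun f := ⟨fun i => f (e i), memℓp_of_sq (e.summable_iff.2 (summable_sq f))⟩
  left_inv f := by ext; simp
  right_inv f := by ext; simp
  map_add' f g := by ext; rfl
  map_smul' c f := by ext; simp
  norm_map' f := by
    rw [← sq_eq_sq₀ (norm_nonneg _) (norm_nonneg _), norm_sq_eq, norm_sq_eq]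
    exact e.symm.tsum_eq fun i => ‖f i‖ ^ 2

/-- The row `j ↦ f (i, j)` of a vector of `ℓ²(a × b)`. -/
def row {a b : Type} (f : L2 (a × b)) (i : a) : L2 b :=
  ⟨fun j => f (i, j), memℓp_of_sq ((summable_sq f).comp_injective (Prod.mk_right_injective i))⟩

theorem summable_row {a b : Type} (f : L2 (a × b)) : Summable fun i => ‖row f i‖ ^ 2 := by
  simp_rw [norm_sq_eq]
  exact ((summable_prod_of_nonneg fun _ => by positivity).1 (summable_sq f)).2

theorem tsum_row {a b : Type} (f : L2 (a × b)) : ∑' i, ‖row f i‖ ^ 2 = ‖f‖ ^ 2 := by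
  simp_rw [norm_sq_eq]
  exact ((summable_sq f).tsum_prod).symm

theorem summable_apply_row {a b b' : Type} (B : L2 b →L[ℂ] L2 b') (f : L2 (a × b)) :
    Summable fun i => ‖B (row f i)‖ ^ 2 := by
  refine Summable.of_nonneg_of_le (fun _ => by positivity) (fun i => ?_)
    ((summable_row f).mul_left (‖B‖ ^ 2))
  rw [← mul_pow]
  gcongr
  exact B.le_opNorm _

theorem summable_apply_row_sq {a b b' : Type} (B : L2 b →L[ℂ] L2 b') (f : L2 (a × b)) :
    Summable fun p : a × b' => ‖B (row f p.1) p.2‖ ^ 2 := by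
  refine (summable_prod_of_nonneg fun _ => by positivity).2
    ⟨fun i => summable_sq (B (row f i)), ?_⟩
  simpa only [norm_sq_eq] using summable_apply_row B f

/-- The operator `1 ⊗ B`. -/
def idTensor (a : Type) {b b' : Type} (B : L2 b →L[ℂ] L2 b') : L2 (a × b) →L[ℂ] L2 (a × b') :=
  LinearMap.mkContinuous
    { toFun := fun f => ⟨fun p => B (row f p.1) p.2, memℓp_of_sq (summable_apply_row_sq B f)⟩
      map_add' := fun f g => by
        ext p
        have : row (f + g) p.1 = row f p.1 + row g p.1 := by ext; rfl
        change B (row (f + g) p.1) p.2 = B (row f p.1) p.2 + B (row g p.1) p.2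
        rw [this, map_add]
        rfl
      map_smul' := fun c f => by
        ext p
        have : row (c • f) p.1 = c • row f p.1 := by ext; simp [row]
        simp [this] } ‖B‖ (fun f => by
    rw [← sq_le_sq₀ (norm_nonneg _) (by positivity), mul_pow, norm_sq_eq, ← tsum_row f,
      ← tsum_mul_left]
    refine ((summable_apply_row_sq B f).tsum_prod).trans_le ?_
    refine Summable.tsum_le_tsum (fun i => ?_) ?_ ((summable_row f).mul_left _)
    · refine (norm_sq_eq (B (row f i))).symm.trans_le ?_
      rw [← mul_pow]
      gcongr
      exact B.le_opNorm _
    · simpa only [norm_sq_eq] using summable_apply_row B f)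

/-- The operator `A ⊗ B`, as the composition of `A ⊗ 1` and `1 ⊗ B`. -/
def opTensor {a a' b b' : Type} (A : L2 a →L[ℂ] L2 a') (B : L2 b →L[ℂ] L2 b') :
    L2 (a × b) →L[ℂ] L2 (a' × b') :=
  ((reindex (Equiv.prodComm b' a')).toContinuousLinearEquiv : L2 (b' × a') →L[ℂ] L2 (a' × b')) ∘L
    idTensor b' A ∘L
    ((reindex (Equiv.prodComm a b')).toContinuousLinearEquiv : L2 (a × b') →L[ℂ] L2 (b' × a)) ∘L
    idTensor a B

/-- Relabelling of the basis in an operator. -/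
def conjReindex {ι κ : Type} (e : ι ≃ κ) (T : Op ι) : Op κ :=
  ((reindex e).toContinuousLinearEquiv : L2 ι →L[ℂ] L2 κ) ∘L T ∘L
    ((reindex e.symm).toContinuousLinearEquiv : L2 κ →L[ℂ] L2 ι)

/-- The `n`-fold tensor power of an operator on `ℓ²(ι)`, acting on `ℓ²(ιⁿ)`. -/
def opPow {ι : Type} (T : Op ι) : (n : ℕ) → Op (Fin n → ι)
  | 0 => 1
  | n + 1 => conjReindex (Fin.consEquiv fun _ : Fin (n + 1) => ι) (opTensor T (opPow T n))

/-- Basis labels of the bipartite system `AⁿBⁿ`, with parties `Aⁿ` and `Bⁿ`. -/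
abbrev Copies (a b : Type) (n : ℕ) : Type := (Fin n → a) × (Fin n → b)

/-- `ρ^{⊗n}` as an operator on the bipartite system `AⁿBⁿ`. -/
def copies {a b : Type} (ρ : Op (a × b)) (n : ℕ) : Op (Copies a b n) :=
  conjReindex (Equiv.arrowProdEquivProdArrow (Fin n) (fun _ => a) (fun _ => b)) (opPow ρ n)

/-! Matrix elements of these operators. -/

theorem ket_apply {ι : Type} [DecidableEq ι] (i j : ι) : (ket i : L2 ι) j = if j = i then 1 else 0 := by
  classical
  by_cases h : j = i
  · subst h; simp [ket]
  · simp [ket, h]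

theorem entry_eq {ι κ : Type} (T : L2 κ →L[ℂ] L2 ι) (i : ι) (j : κ) :
    entry T i j = T (ket j) i := inner_ket _ _

theorem reindex_ket {ι κ : Type} (e : ι ≃ κ) (i : ι) : reindex e (ket i) = ket (e i) := by
  classical
  ext k
  change (ket i : L2 ι) (e.symm k) = _
  simp [ket_apply, Equiv.symm_apply_eq]

theorem entry_conjReindex {ι κ : Type} (e : ι ≃ κ) (T : Op ι) (k l : κ) :
    entry (conjReindex e T) k l = entry T (e.symm k) (e.symm l) := by
  rw [entry_eq, entry_eq]
  change T (reindex e.symm (ket l)) (e.symm k) = _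
  rw [reindex_ket]

theorem row_ket {a b : Type} [DecidableEq a] (i i' : a) (j : b) :
    row (ket (i, j)) i' = if i' = i then ket j else 0 := by
  classical
  ext j'
  change (ket (i, j) : L2 (a × b)) (i', j') = _
  by_cases h : i' = i
  · simp [ket_apply, h]
  · simp [ket_apply, h]

theorem idTensor_ket {a b b' : Type} (B : L2 b →L[ℂ] L2 b') (i : a) (j : b) :
    idTensor a B (ket (i, j)) = tensorVec (ket i) (B (ket j)) := by
  classical
  ext p
  change B (row (ket (i, j)) p.1) p.2 = (ket i : L2 a) p.1 * (B (ket j)) p.2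
  by_cases h : p.1 = i
  · simp [row_ket, ket_apply, h]
  · simp [row_ket, ket_apply, h]

theorem entry_opTensor {a a' b b' : Type} (A : L2 a →L[ℂ] L2 a') (B : L2 b →L[ℂ] L2 b')
    (x : a' × b') (y : a × b) : entry (opTensor A B) x y = entry A x.1 y.1 * entry B x.2 y.2 := by
  classical
  obtain ⟨i, j⟩ := y
  rw [entry_eq, entry_eq, entry_eq]
  change A (row (reindex (Equiv.prodComm a b') (idTensor a B (ket (i, j)))) x.2) x.1 = _
  rw [idTensor_ket]
  have : row (reindex (Equiv.prodComm a b') (tensorVec (ket i) (B (ket j)))) x.2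
      = (B (ket j) x.2) • ket i := by
    ext k
    change (ket i : L2 a) k * (B (ket j)) x.2 = _
    simp [mul_comm]
  rw [this]
  simp [mul_comm]

theorem entry_copies {a b : Type} (ρ : Op (a × b)) (n : ℕ) (x y : Copies a b n) :
    entry (copies ρ n) x y = ∏ k, entry ρ (x.1 k, x.2 k) (y.1 k, y.2 k) := by
  have key : ∀ (n : ℕ) (x y : Fin n → a × b),
      entry (opPow ρ n) x y = ∏ k, entry ρ (x k) (y k) := by
    intro n
    induction n with
    | zero =>
      intro x y
      classical
      simp [opPow, entry_eq, ket_apply, Subsingleton.elim x y]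
    | succ n ih =>
      intro x y
      rw [opPow, entry_conjReindex, entry_opTensor, ih, Fin.prod_univ_succ]
      rfl
  rw [copies, entry_conjReindex, key]
  rfl

/-! ### Partial transposition, the separable cone and the PPT cone -/

/-- The bounded operator `Y` is the partial transpose `X^Γ` of the bounded operator `X`, that is,
`⟨i j|Y|i' j'⟩ = ⟨i j'|X|i' j⟩`. There is at most one such `Y`. If `X` is of trace class there is
one, and `X ↦ Y` is then the continuous linear extension of `X_A ⊗ X_B ↦ X_A ⊗ X_Bᵀ`; the partial
transpose of a general bounded operator need not be bounded. -/
def IsPartialTranspose {a b : Type} (X Y : Op (a × b)) : Prop :=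
  ∀ (i i' : a) (j j' : b), entry Y (i, j) (i', j') = entry X (i, j') (i', j)

/-- The pure product states. -/
def pureProductStates (a b : Type) : Set (Op (a × b)) :=
  {σ | ∃ (ψ : L2 a) (φ : L2 b), ‖ψ‖ = 1 ∧ ‖φ‖ = 1 ∧ σ = proj (tensorVec ψ φ)}

/-- The separable states: the trace norm closure, among the trace class operators, of the convex
hull of the pure product states. -/
def separableStates (a b : Type) : Set (Op (a × b)) :=
  {σ | IsTraceClass σ ∧ ∀ ε : ℝ≥0∞, 0 < ε →
    ∃ τ ∈ convexHull ℝ (pureProductStates a b), traceNorm (σ - τ) < ε}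

/-- The cone generated by the separable states. -/
def separableCone (a b : Type) : Set (Op (a × b)) :=
  {T | ∃ c : ℝ, 0 ≤ c ∧ ∃ σ ∈ separableStates a b, T = c • σ}

/-- The cone of positive trace class operators with positive partial transpose. -/
def pptCone (a b : Type) : Set (Op (a × b)) :=
  {T | IsTraceClass T ∧ 0 ≤ T ∧ ∃ Y, IsPartialTranspose T Y ∧ 0 ≤ Y}

/-- The two choices of the cone `K`. -/
inductive ConeKind
  | sep
  | ppt

/-- The cone `K_{AB}`. -/
def cone : ConeKind → (a b : Type) → Set (Op (a × b))
  | .sep => separableCone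
  | .ppt => pptCone

/-! ### Operations -/

/-- Positive trace preserving linear maps from the trace class operators on `ℓ²(ι)` to those on
`ℓ²(κ)`. The values of `toFun` outside the trace class are irrelevant. -/
structure PTPMap (ι κ : Type) where
  toFun : Op ι → Op κ
  traceClass : ∀ T, IsTraceClass T → IsTraceClass (toFun T)
  map_add : ∀ S T, IsTraceClass S → IsTraceClass T → toFun (S + T) = toFun S + toFun T
  map_smul : ∀ (c : ℂ) (T), IsTraceClass T → toFun (c • T) = c • toFun T
  nonneg : ∀ T, IsTraceClass T → 0 ≤ T → 0 ≤ toFun T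
  trace_eq : ∀ T, IsTraceClass T → trace (toFun T) = trace T

/-- The `K`-preserving operations from `AB` to `A'B'`. -/
def preserving (K : ConeKind) (a b a' b' : Type) : Set (PTPMap (a × b) (a' × b')) :=
  {Λ | ∀ T ∈ cone K a b, Λ.toFun T ∈ cone K a' b'}

/-- `LOCCProtocol a' b' a b M`: there is a protocol of finitely many rounds of local measurements
and classical communication, starting with the local systems `ℓ²(a)`, `ℓ²(b)` and ending with
`ℓ²(a')`, `ℓ²(b')`, such that `M k = (A_k, B_k)` are the overall Kraus operators of the two parties
for the sequence `k` of all measurement outcomes. In a round, one party applies a measurement with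
countably many Kraus operators `E x`, `∑ₓ (E x)† (E x) = 1`, and announces the outcome `x`; the
rest of the protocol may depend on `x`. -/
inductive LOCCProtocol (a' b' : Type) :
    (a b : Type) → {κ : Type} → (κ → (L2 a →L[ℂ] L2 a') × (L2 b →L[ℂ] L2 b')) → Prop
  | done : LOCCProtocol a' b' a' b' fun _ : Unit =>
      (ContinuousLinearMap.id ℂ (L2 a'), ContinuousLinearMap.id ℂ (L2 b'))
  | alice {a b X : Type} [Countable X] {c : X → Type} [∀ x, Countable (c x)]
      (E : (x : X) → L2 a →L[ℂ] L2 (c x))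
      (complete : ∀ ψ : L2 a, HasSum (fun x => ‖E x ψ‖ ^ 2) (‖ψ‖ ^ 2))
      {κ : X → Type} (M : (x : X) → κ x → (L2 (c x) →L[ℂ] L2 a') × (L2 b →L[ℂ] L2 b'))
      (rest : ∀ x, LOCCProtocol a' b' (c x) b (M x)) :
      LOCCProtocol a' b' a b fun k : Σ x, κ x => ((M k.1 k.2).1 ∘L E k.1, (M k.1 k.2).2)
  | bob {a b X : Type} [Countable X] {c : X → Type} [∀ x, Countable (c x)]
      (E : (x : X) → L2 b →L[ℂ] L2 (c x))
      (complete : ∀ ψ : L2 b, HasSum (fun x => ‖E x ψ‖ ^ 2) (‖ψ‖ ^ 2))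
      {κ : X → Type} (M : (x : X) → κ x → (L2 a →L[ℂ] L2 a') × (L2 (c x) →L[ℂ] L2 b'))
      (rest : ∀ x, LOCCProtocol a' b' a (c x) (M x)) :
      LOCCProtocol a' b' a b fun k : Σ x, κ x => ((M k.1 k.2).1, (M k.1 k.2).2 ∘L E k.1)

/-- The LOCC operations from `AB` to `A'B'`: the maps
`Λ(T) = ∑ₖ (A_k ⊗ B_k) T (A_k ⊗ B_k)†` implemented by some protocol. -/
def locc (a b a' b' : Type) : Set (PTPMap (a × b) (a' × b')) :=
  {Λ | ∃ (κ : Type) (M : κ → (L2 a →L[ℂ] L2 a') × (L2 b →L[ℂ] L2 b')),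
    LOCCProtocol a' b' a b M ∧ ∀ T, IsTraceClass T → ∀ x y : a' × b',
      HasSum (fun k => entry (opTensor (M k).1 (M k).2 ∘L T ∘L
        ContinuousLinearMap.adjoint (opTensor (M k).1 (M k).2)) x y) (entry (Λ.toFun T) x y)}

/-! ### The entanglement cost -/

/-- The vector `(|00⟩ + |11⟩)/√2`. -/
def bellVec : L2 (Fin 2 × Fin 2) := ((1 / √2 : ℝ) : ℂ) • (ket (0, 0) + ket (1, 1))

/-- The entanglement bit `Φ₂`. -/
def ebit : Op (Fin 2 × Fin 2) := proj bellVec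

/-- The entanglement cost of `ρ` at error threshold `ε`, where `F m n` is the set of allowed
operations from `m` pairs of qubits to `n` copies of `AB`; it is `⊤` if no rate is achievable. -/
def cost {a b : Type} (F : (m n : ℕ) → Set (PTPMap (Copies (Fin 2) (Fin 2) m) (Copies a b n)))
    (ε : ℝ) (ρ : Op (a × b)) : EReal :=
  sInf {r : EReal | ∃ R : ℝ, r = (R : EReal) ∧ 0 < R ∧
    limsup (fun n : ℕ => ⨅ Λ ∈ F ⌊R * n⌋₊ n,
      traceNorm (Λ.toFun (copies ebit ⌊R * n⌋₊) - copies ρ n) / 2) atTop ≤ ENNReal.ofReal ε}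

/-- The entanglement cost under `K`-preserving operations at error threshold `ε`. -/
def costKP (K : ConeKind) {a b : Type} (ε : ℝ) (ρ : Op (a × b)) : EReal :=
  cost (fun m n => preserving K (Fin m → Fin 2) (Fin m → Fin 2) (Fin n → a) (Fin n → b)) ε ρ

/-- The entanglement cost under LOCC, with asymptotically vanishing error. -/
def costLOCC {a b : Type} (ρ : Op (a × b)) : EReal :=
  cost (fun m n => locc (Fin m → Fin 2) (Fin m → Fin 2) (Fin n → a) (Fin n → b)) 0 ρ

/-! ### Tempered robustness and tempered negativity -/

/-- The operator interval `[-1, 1]_{K*}`. -/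
def dualInterval (K : ConeKind) (a b : Type) : Set (Op (a × b)) :=
  {X | IsSelfAdjoint X ∧ ∀ W ∈ cone K a b, ‖trace (X ∘L W)‖ ≤ (trace W).re}

/-- `1 + 2 R^τ_K(ρ|ω) = sup {Tr Xρ : X ∈ [-1, 1]_{K*}, ‖X‖_∞ = Tr Xω}`. As `X = 1` is feasible
and has the value `1` for states `ρ`, `ω`, negative values of `Tr Xρ` play no role. -/
def temperedBaseNorm (K : ConeKind) {a b : Type} (ρ ω : Op (a × b)) : ℝ≥0∞ :=
  ⨆ X ∈ {X | X ∈ dualInterval K a b ∧ ‖X‖ = (trace (X ∘L ω)).re},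
    ENNReal.ofReal (trace (X ∘L ρ)).re

/-- The tempered robustness `R^τ_K(ρ) = R^τ_K(ρ|ρ)`. -/
def temperedRobustness (K : ConeKind) {a b : Type} (ρ : Op (a × b)) : ℝ≥0∞ :=
  (temperedBaseNorm K ρ ρ - 1) / 2

/-- The tempered negativity
`N_τ(ρ|ω) = sup {Tr Xρ : X self-adjoint, ‖X^Γ‖_∞ ≤ 1, ‖X‖_∞ = Tr Xω}`. -/
def temperedNegativity {a b : Type} (ρ ω : Op (a × b)) : ℝ≥0∞ :=
  ⨆ X ∈ {X : Op (a × b) | IsSelfAdjoint X ∧ (∃ Y, IsPartialTranspose X Y ∧ ‖Y‖ ≤ 1) ∧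
    ‖X‖ = (trace (X ∘L ω)).re}, ENNReal.ofReal (trace (X ∘L ρ)).re

/-- Base-two logarithm, with `log₂ 0 = -∞` and `log₂ ∞ = ∞`. -/
def log2 (x : ℝ≥0∞) : EReal := ENNReal.log x / (Real.log 2 : EReal)

/-- `L^τ_K(ρ) = limsup_n (1/n) log₂ (1 + R^τ_K(ρ^{⊗n}))`. -/
def regTemperedRobustness (K : ConeKind) {a b : Type} (ρ : Op (a × b)) : EReal :=
  limsup (fun n : ℕ => log2 (1 + temperedRobustness K (copies ρ n)) / (n : EReal)) atTop

/-- The tempered logarithmic negativity `E^τ_N(ρ) = log₂ N_τ(ρ|ρ)`. -/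
def temperedLogNegativity {a b : Type} (ρ : Op (a × b)) : EReal := log2 (temperedNegativity ρ ρ)

/-- The optimal value of the semi-definite program with real linear objective `Tr Xρ`, over pairs
of self-adjoint operators `X` and `Y = X^Γ` subject to the linear operator inequalities
`-1 ≤ Y ≤ 1` and `-(Tr Xρ) 1 ≤ X ≤ (Tr Xρ) 1`. -/
def negativitySDP {a b : Type} (ρ : Op (a × b)) : ℝ≥0∞ :=
  ⨆ X ∈ {X : Op (a × b) | IsSelfAdjoint X ∧
    (∃ Y, IsSelfAdjoint Y ∧ IsPartialTranspose X Y ∧ -1 ≤ Y ∧ Y ≤ 1) ∧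
    -((trace (X ∘L ρ)).re • (1 : Op (a × b))) ≤ X ∧ X ≤ (trace (X ∘L ρ)).re • (1 : Op (a × b))},
    ENNReal.ofReal (trace (X ∘L ρ)).re

end

end Ent

/-!
The argument compares operators through their traces against test operators `X`.

A positive trace class operator `W` is written as `∑ₖ |vₖ⟩⟨vₖ|` with `∑ₖ ‖vₖ‖² = Tr W`
(`IsEnsemble`; the vectors `√W |k⟩` will do). Then `Tr X W = ∑ₖ ⟨vₖ|X|vₖ⟩` is absolutely convergent,
which yields `|Tr X W| ≤ ‖X‖ Tr W`, convergence of the finite truncations, and, by the Jordan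
decomposition, `|Tr X T| ≤ ‖X‖ ‖T‖₁` for self-adjoint `T`. The first of these inequalities gives
`Tr X ρ ≤ ‖X‖`, so that the two programs for `N_τ(ρ)` have the same feasible points.

*The regularized robustness is at least `E^τ_N`.* If `‖X^Γ‖ ≤ 1`, then
`|Tr X W| = |Tr X^Γ W^Γ| ≤ Tr W^Γ = Tr W` for `W` in the PPT cone, and in particular for product
states, from which it extends to the separable cone by convexity and trace norm continuity
(`mem_dualInterval_of_isPartialTranspose`). The constraint `‖X‖ = Tr X ρ` and all other data are
multiplicative under tensor powers, so `X^{⊗n}` is feasible for `R^τ_K(ρ^{⊗n})` and has the value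
`(Tr X ρ)ⁿ` (`ofReal_pow_le_temperedBaseNorm`).

*The cost is at least the regularized robustness.* By polarization, `m` entanglement bits
`2⁻ᵐ ∑ₛₜ |ss⟩⟨tt|` are a combination of product states with coefficients of total size `O(2ᵐ)`
(`copies_ebit_eq`). An operation `Λ` that sends product states into the cone `K` therefore satisfies
`|Tr X Λ(Φ₂^{⊗m})| ≤ 16 · 2ᵐ` for `X` in the dual interval of `K`. If `Λ(Φ₂^{⊗m})` has trace
distance less than `ε` from `σ = ρ^{⊗n}` and `‖X‖ = Tr X σ`, then the error in `Tr X σ` is at most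
`2 ε Tr X σ`, whence `(1 - 2 ε) Tr X σ ≤ 16 · 2ᵐ` (`temperedBaseNorm_le_of_approx`). With
`m = ⌊R n⌋` and `n → ∞` this bounds the regularized robustness by the rate `R`.

Besides positivity and preservation of the trace, only the values of `Λ` on product states enter
(`BoundedOnProducts`). LOCC operations send them to sums of product states
by their Kraus form, so that the same bound, for the separable cone, applies to them.
-/

namespace Ent

open scoped ComplexConjugate ComplexOrder

theorem _root_.HasSum.congr_terms {κ : Type*} {f g : κ → ℂ} {s : ℂ} (h : HasSum f s)
    (hfg : ∀ k, g k = f k) : HasSum g s := by rwa [funext hfg]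

/-! ### Positive operators on Hilbert spaces -/

theorem norm_le_iff_neg_le_and_le {A : Type*} [CStarAlgebra A] [PartialOrder A] [StarOrderedRing A]
    {x : A} (hx : IsSelfAdjoint x) {c : ℝ} (hc : 0 ≤ c) :
    ‖x‖ ≤ c ↔ -(algebraMap ℝ A c) ≤ x ∧ x ≤ algebraMap ℝ A c := by
  constructor
  · intro h
    have h1 : algebraMap ℝ A ‖x‖ ≤ algebraMap ℝ A c := algebraMap_mono A h
    exact ⟨(neg_le_neg h1).trans hx.neg_algebraMap_norm_le_self,
      hx.le_algebraMap_norm_self.trans h1⟩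
  · rintro ⟨h1, h2⟩
    rcases subsingleton_or_nontrivial A with hA | hA
    · simpa [Subsingleton.elim x 0] using hc
    rw [← map_neg, algebraMap_le_iff_le_spectrum] at h1
    rw [le_algebraMap_iff_spectrum_le] at h2
    rcases CStarAlgebra.norm_or_neg_norm_mem_spectrum hx with h | h
    · exact h2 _ h
    · simpa using h1 _ h

section Hilbert

variable {H : Type*} [NormedAddCommGroup H] [InnerProductSpace ℂ H] [CompleteSpace H]

theorem exists_symmetric_sqrt {W : H →L[ℂ] H} (hW : 0 ≤ W) :
    ∃ S : H →L[ℂ] H, (∀ f g, inner ℂ (S f) g = inner ℂ f (S g)) ∧ ∀ f, S (S f) = W f := by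
  have hSW := CFC.sqrt_mul_sqrt_self W hW
  have hS := IsSelfAdjoint.of_nonneg (CFC.sqrt_nonneg W)
  refine ⟨CFC.sqrt W, fun f g => ?_, fun f => congrArg (fun T : H →L[ℂ] H => T f) hSW⟩
  conv_lhs => rw [← ContinuousLinearMap.isSelfAdjoint_iff'.1 hS]
  exact ContinuousLinearMap.adjoint_inner_left _ _ _

theorem opAbs_of_nonneg {T : H →L[ℂ] H} (hT : 0 ≤ T) : opAbs T = T := CFC.abs_of_nonneg T hT

theorem opAbs_nonneg (T : H →L[ℂ] H) : 0 ≤ opAbs T := CFC.abs_nonneg T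

theorem norm_opAbs (T : H →L[ℂ] H) : ‖opAbs T‖ = ‖T‖ := CFC.norm_abs

/-- The Jordan decomposition of a self-adjoint operator into its positive and negative parts. -/
theorem exists_jordan {T : H →L[ℂ] H} (hT : IsSelfAdjoint T) :
    ∃ P N : H →L[ℂ] H, 0 ≤ P ∧ 0 ≤ N ∧ T = P - N ∧ opAbs T = P + N :=
  ⟨T⁺, T⁻, CFC.posPart_nonneg T, CFC.negPart_nonneg T, (CFC.posPart_sub_negPart T hT).symm,
    (CFC.posPart_add_negPart T hT).symm⟩

theorem isClosed_nonneg_op : IsClosed {T : H →L[ℂ] H | 0 ≤ T} := CStarAlgebra.isClosed_nonneg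

theorem real_smul_nonneg_op {c : ℝ} (hc : 0 ≤ c) {T : H →L[ℂ] H} (hT : 0 ≤ T) : 0 ≤ c • T :=
  smul_nonneg hc hT

theorem norm_le_iff_of_isSelfAdjoint {T : H →L[ℂ] H} (hT : IsSelfAdjoint T) {c : ℝ} (hc : 0 ≤ c) :
    ‖T‖ ≤ c ↔ -(c • (1 : H →L[ℂ] H)) ≤ T ∧ T ≤ c • (1 : H →L[ℂ] H) := by
  simpa only [Algebra.algebraMap_eq_smul_one] using norm_le_iff_neg_le_and_le hT hc

theorem norm_le_one_iff_of_isSelfAdjoint {T : H →L[ℂ] H} (hT : IsSelfAdjoint T) :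
    ‖T‖ ≤ 1 ↔ -1 ≤ T ∧ T ≤ 1 := by
  rw [norm_le_iff_of_isSelfAdjoint hT zero_le_one, one_smul]

end Hilbert

/-! ### Matrix elements and ensembles of vectors -/

theorem hasSum_smul_ket {ι : Type} (f : L2 ι) : HasSum (fun i => f i • ket i) f := by
  classical
  convert lp.hasSum_single (E := fun _ : ι => ℂ) (p := 2) (by norm_num) f using 2 with i
  ext j
  by_cases h : j = i
  · subst h; simp [ket]
  · simp [ket, h]

/-- Bounded operators are determined by their matrix elements. -/
theorem ext_entry {ι κ : Type} {S T : L2 κ →L[ℂ] L2 ι}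
    (h : ∀ i j, entry S i j = entry T i j) : S = T := by
  have hket : ∀ j, S (ket j) = T (ket j) := fun j => by
    ext i
    simpa [entry_eq] using h i j
  ext1 f
  have hS := (hasSum_smul_ket f).mapL S
  have hT := (hasSum_smul_ket f).mapL T
  simp only [map_smul, hket] at hS hT
  exact hS.unique hT

theorem entry_adjoint {ι κ : Type} (T : L2 κ →L[ℂ] L2 ι) (i : κ) (j : ι) :
    entry (ContinuousLinearMap.adjoint T) i j = conj (entry T j i) := by
  rw [entry, ContinuousLinearMap.adjoint_inner_right, entry, inner_conj_symm]

theorem isSelfAdjoint_iff_entry {ι : Type} {X : Op ι} :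
    IsSelfAdjoint X ↔ ∀ i j, conj (entry X j i) = entry X i j := by
  rw [ContinuousLinearMap.isSelfAdjoint_iff']
  constructor
  · intro h i j
    rw [← entry_adjoint, h]
  · intro h
    exact ext_entry fun i j => by rw [entry_adjoint, h]

theorem norm_ket {ι : Type} (i : ι) : ‖(ket i : L2 ι)‖ = 1 := by
  classical
  simp [ket, lp.norm_single]

theorem entry_add {ι κ : Type} (S T : L2 κ →L[ℂ] L2 ι) (i : ι) (j : κ) :
    entry (S + T) i j = entry S i j + entry T i j := by
  simp [entry]

theorem entry_sub {ι κ : Type} (S T : L2 κ →L[ℂ] L2 ι) (i : ι) (j : κ) :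
    entry (S - T) i j = entry S i j - entry T i j := by
  simp [entry]

theorem entry_smul {ι κ : Type} (c : ℂ) (T : L2 κ →L[ℂ] L2 ι) (i : ι) (j : κ) :
    entry (c • T) i j = c * entry T i j := by
  simp [entry]

theorem entry_real_smul {ι : Type} (c : ℝ) (T : Op ι) (i j : ι) :
    entry (c • T) i j = c * entry T i j := by
  exact entry_smul (c : ℂ) T i j

theorem entry_diag_nonneg {ι : Type} {W : Op ι} (hW : 0 ≤ W) (i : ι) : 0 ≤ entry W i i :=
  ((ContinuousLinearMap.nonneg_iff_isPositive W).1 hW).inner_nonneg_right _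

theorem entry_proj {ι : Type} (ψ : L2 ι) (i j : ι) : entry (proj ψ) i j = ψ i * conj (ψ j) := by
  rw [entry, proj, InnerProductSpace.rankOne_apply, inner_smul_right, inner_ket,
    ← inner_conj_symm, inner_ket, mul_comm]

/-- `W = ∑ₖ |v k⟩⟨v k|` with `∑ₖ ‖v k‖² < ∞`, the sum being understood in the sense of matrix
elements. Every positive trace class operator has this form, see `exists_isEnsemble`. -/
structure IsEnsemble {ι κ : Type} (v : κ → L2 ι) (W : Op ι) : Prop where
  summable : Summable fun k => ‖v k‖ ^ 2
  hasSum : ∀ x y, HasSum (fun k => v k x * conj (v k y)) (entry W x y)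

theorem norm_apply_le {ι : Type} (f : L2 ι) (i : ι) : ‖f i‖ ≤ ‖f‖ :=
  lp.norm_apply_le_norm (by norm_num) f i

theorem IsEnsemble.summable_apply {ι κ : Type} {v : κ → L2 ι} {W : Op ι} (h : IsEnsemble v W)
    (x : ι) : Summable fun k => conj (v k x) • v k := by
  refine Summable.of_norm_bounded h.summable fun k => ?_
  rw [norm_smul, RCLike.norm_conj, sq]
  gcongr
  exact norm_apply_le _ _

theorem IsEnsemble.hasSum_apply {ι κ : Type} {v : κ → L2 ι} {W : Op ι} (h : IsEnsemble v W)
    (x : ι) : HasSum (fun k => conj (v k x) • v k) (W (ket x)) := by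
  obtain ⟨w, hw⟩ := h.summable_apply x
  convert hw
  ext y
  rw [← entry_eq]
  refine (h.hasSum y x).unique ?_
  have := hw.mapL (innerSL ℂ (ket y))
  simpa [inner_ket, inner_smul_right, mul_comm] using this

theorem entry_comp {ι κ μ : Type} (X : L2 κ →L[ℂ] L2 μ) (W : L2 ι →L[ℂ] L2 κ) (x : μ) (y : ι) :
    entry (X ∘L W) x y = X (W (ket y)) x := entry_eq _ _ _

/-- The terms of `∑ₖ ⟨v k|X|v k⟩`, expanded in the basis, form an absolutely summable family. This
justifies the exchange of sums behind `IsEnsemble.hasSum_trace`. -/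
theorem IsEnsemble.summable_prod {ι κ : Type} {v : κ → L2 ι} {W : Op ι} (h : IsEnsemble v W)
    (X : Op ι) : Summable fun p : κ × ι => conj (v p.1 p.2) * X (v p.1) p.2 := by
  have hk : ∀ k, Summable fun x => ‖conj (v k x) * X (v k) x‖ := fun k => by
    simpa [mul_comm] using (lp.summable_inner (𝕜 := ℂ) (v k) (X (v k))).norm
  refine Summable.of_norm ((summable_prod_of_nonneg fun _ => norm_nonneg _).2 ⟨hk, ?_⟩)
  refine Summable.of_nonneg_of_le (fun k => tsum_nonneg fun _ => norm_nonneg _) (fun k => ?_)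
    (h.summable.mul_left (((‖X‖ ^ 2 + 1) / 2)))
  have h1 : Summable fun x => ((‖v k x‖ ^ 2 + ‖X (v k) x‖ ^ 2) / 2) :=
    ((summable_sq _).add (summable_sq _)).div_const 2
  refine ((hk k).tsum_le_tsum (fun x => ?_) h1).trans ?_
  · rw [norm_mul, RCLike.norm_conj]
    nlinarith [sq_nonneg (‖v k x‖ - ‖X (v k) x‖)]
  · rw [tsum_div_const, (summable_sq _).tsum_add (summable_sq _), ← norm_sq_eq, ← norm_sq_eq]
    have := pow_le_pow_left₀ (norm_nonneg _) (X.le_opNorm (v k)) 2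
    rw [mul_pow] at this
    linarith

theorem IsEnsemble.hasSum_entry_comp {ι κ : Type} {v : κ → L2 ι} {W : Op ι} (h : IsEnsemble v W)
    (X : Op ι) (x : ι) :
    HasSum (fun k => conj (v k x) * X (v k) x) (entry (X ∘L W) x x) := by
  have := ((h.hasSum_apply x).mapL X).mapL (innerSL ℂ (ket x))
  simpa [inner_ket, inner_smul_right, entry_comp] using this

theorem IsEnsemble.summable_entry_comp {ι κ : Type} {v : κ → L2 ι} {W : Op ι}
    (h : IsEnsemble v W) (X : Op ι) : Summable fun x => entry (X ∘L W) x x := by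
  have hs := (h.summable_prod X).prod_symm.prod
  exact hs.congr fun x => (h.hasSum_entry_comp X x).tsum_eq

/-- `Tr X W = ∑ₖ ⟨v k|X|v k⟩`. -/
theorem IsEnsemble.hasSum_trace {ι κ : Type} {v : κ → L2 ι} {W : Op ι} (h : IsEnsemble v W)
    (X : Op ι) : HasSum (fun k => inner ℂ (v k) (X (v k))) (trace (X ∘L W)) := by
  have hs := h.summable_prod X
  have h1 : HasSum (fun k => ∑' x, conj (v k x) * X (v k) x) (∑' p : κ × ι, _) :=
    hs.hasSum.prod_fiberwise fun k => (hs.prod_factor k).hasSum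
  have h2 : trace (X ∘L W) = ∑' p : κ × ι, conj (v p.1 p.2) * X (v p.1) p.2 :=
    (tsum_congr fun x => (h.hasSum_entry_comp X x).tsum_eq.symm).trans
      (hs.prod_symm.tsum_prod.symm.trans ((Equiv.prodComm ι κ).tsum_eq
        fun p : κ × ι => (conj (v p.1 p.2) * X (v p.1) p.2 : ℂ)))
  rw [h2]
  refine h1.congr_terms fun k => ?_
  rw [lp.inner_eq_tsum]
  exact tsum_congr fun x => by rw [RCLike.inner_apply, mul_comm]

theorem IsEnsemble.summable_entry {ι κ : Type} {v : κ → L2 ι} {W : Op ι}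
    (h : IsEnsemble v W) : Summable fun x => entry W x x :=
  h.summable_entry_comp (1 : Op ι)

theorem IsEnsemble.hasSum_norm_sq {ι κ : Type} {v : κ → L2 ι} {W : Op ι}
    (h : IsEnsemble v W) : HasSum (fun k => ‖v k‖ ^ 2) (trace W).re := by
  have h1 : HasSum (fun k => (inner ℂ (v k) (v k)).re) (trace W).re :=
    Complex.hasSum_re (h.hasSum_trace (1 : Op ι))
  convert h1 using 1
  funext k
  simp [inner_self_eq_norm_sq_to_K, ← Complex.ofReal_pow]

/-- If the form of `X` is bounded by `c` on the vectors of an ensemble of `W`, then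
`|Tr X W| ≤ c Tr W`. -/
theorem IsEnsemble.norm_trace_le_of_forall {ι κ : Type} {v : κ → L2 ι} {W : Op ι}
    (h : IsEnsemble v W) {X : Op ι} {c : ℝ}
    (hc : ∀ k, ‖inner ℂ (v k) (X (v k))‖ ≤ c * ‖v k‖ ^ 2) :
    ‖trace (X ∘L W)‖ ≤ c * (trace W).re := by
  rw [← (h.hasSum_trace X).tsum_eq]
  exact tsum_of_norm_bounded (h.hasSum_norm_sq.mul_left c) hc

theorem IsEnsemble.norm_trace_le {ι κ : Type} {v : κ → L2 ι} {W : Op ι}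
    (h : IsEnsemble v W) (X : Op ι) : ‖trace (X ∘L W)‖ ≤ ‖X‖ * (trace W).re :=
  h.norm_trace_le_of_forall fun k => by
    refine (norm_inner_le_norm _ _).trans ?_
    rw [sq, mul_left_comm]
    gcongr
    exact X.le_opNorm _

/-- The vectors are the images of the basis under `√W`. -/
theorem exists_isEnsemble {ι : Type} {W : Op ι} (hW : 0 ≤ W)
    (hs : Summable fun x => entry W x x) : ∃ v : ι → L2 ι, IsEnsemble v W := by
  obtain ⟨S, hsym, hSW⟩ := exists_symmetric_sqrt hW
  refine ⟨fun k => S (ket k), ?_, fun x y => ?_⟩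
  · convert (Complex.hasSum_re hs.hasSum).summable using 2 with k
    rw [entry, ← hSW, ← hsym, inner_self_eq_norm_sq_to_K]
    simp [← Complex.ofReal_pow]
  · have h1 : entry W x y = inner ℂ (S (ket x)) (S (ket y)) := by
      rw [entry, ← hSW, hsym]
    rw [h1]
    refine (lp.hasSum_inner (𝕜 := ℂ) (S (ket x)) (S (ket y))).congr_terms fun k => ?_
    have h2 : ∀ x, S (ket k) x = conj (S (ket x) k) := fun x => by
      rw [← inner_ket, ← hsym, ← inner_ket, inner_conj_symm]
    rw [RCLike.inner_apply, h2 x, h2 y, Complex.conj_conj]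
    exact mul_comm _ _

/-! ### Trace class operators -/

theorem entry_diag_eq_ofReal {ι : Type} {W : Op ι} (hW : 0 ≤ W) (x : ι) :
    entry W x x = ((entry W x x).re : ℂ) :=
  Complex.ext rfl (Complex.nonneg_iff.1 (entry_diag_nonneg hW x)).2.symm

theorem isTraceClass_iff {ι : Type} {T : Op ι} :
    IsTraceClass T ↔ Summable fun x => entry (opAbs T) x x := by
  have h0 : ∀ x, 0 ≤ (entry (opAbs T) x x).re := fun x =>
    (Complex.nonneg_iff.1 (entry_diag_nonneg (opAbs_nonneg T) x)).1
  constructor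
  · intro h
    have := ENNReal.summable_toReal (ne_of_lt h)
    simp only [ENNReal.toReal_ofReal (h0 _)] at this
    rw [funext fun x => entry_diag_eq_ofReal (opAbs_nonneg T) x]
    exact Complex.hasSum_ofReal.2 this.hasSum |>.summable
  · intro h
    have := (Complex.hasSum_re h.hasSum).summable
    rw [IsTraceClass, traceNorm, ← ENNReal.ofReal_tsum_of_nonneg h0 this]
    exact ENNReal.ofReal_lt_top

theorem isTraceClass_iff_of_nonneg {ι : Type} {W : Op ι} (hW : 0 ≤ W) :
    IsTraceClass W ↔ Summable fun x => entry W x x := by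
  rw [isTraceClass_iff, opAbs_of_nonneg hW]

theorem isTraceClass_of_finite {ι : Type} [Finite ι] (T : Op ι) : IsTraceClass T :=
  isTraceClass_iff.2 Summable.of_finite

theorem toReal_traceNorm {ι : Type} (T : Op ι) (hT : IsTraceClass T) :
    (traceNorm T).toReal = (trace (opAbs T)).re := by
  have h0 : ∀ x, 0 ≤ (entry (opAbs T) x x).re := fun x =>
    (Complex.nonneg_iff.1 (entry_diag_nonneg (opAbs_nonneg T) x)).1
  have hs := Complex.hasSum_re (isTraceClass_iff.1 hT).hasSum
  rw [traceNorm, ENNReal.tsum_toReal_eq fun _ => ENNReal.ofReal_ne_top]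
  simp only [ENNReal.toReal_ofReal (h0 _)]
  exact hs.tsum_eq

theorem IsTraceClass.exists_isEnsemble {ι : Type} {W : Op ι} (h : IsTraceClass W) (hW : 0 ≤ W) :
    ∃ v : ι → L2 ι, IsEnsemble v W :=
  Ent.exists_isEnsemble hW ((isTraceClass_iff_of_nonneg hW).1 h)

theorem IsEnsemble.isTraceClass {ι κ : Type} {v : κ → L2 ι} {W : Op ι} (h : IsEnsemble v W)
    (hW : 0 ≤ W) : IsTraceClass W :=
  (isTraceClass_iff_of_nonneg hW).2 h.summable_entry

theorem trace_add {ι : Type} {S T : Op ι} (hS : Summable fun x => entry S x x)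
    (hT : Summable fun x => entry T x x) : trace (S + T) = trace S + trace T := by
  simp only [trace, entry_add]
  exact hS.tsum_add hT

theorem trace_sub {ι : Type} {S T : Op ι} (hS : Summable fun x => entry S x x)
    (hT : Summable fun x => entry T x x) : trace (S - T) = trace S - trace T := by
  simp only [trace, entry_sub]
  exact hS.tsum_sub hT

theorem trace_smul {ι : Type} (c : ℂ) (T : Op ι) : trace (c • T) = c * trace T := by
  simp only [trace, entry_smul, tsum_mul_left]

theorem trace_real_smul {ι : Type} (c : ℝ) (T : Op ι) : trace (c • T) = c * trace T :=
  trace_smul (c : ℂ) T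

/-- Hölder's inequality for self-adjoint trace class operators, from their Jordan decomposition. -/
theorem norm_trace_comp_le {ι : Type} {T : Op ι} (hT : IsTraceClass T) (hsa : IsSelfAdjoint T)
    (X : Op ι) : ‖trace (X ∘L T)‖ ≤ ‖X‖ * (traceNorm T).toReal := by
  obtain ⟨P, N, hP, hN, hPN, habs⟩ := exists_jordan hsa
  have hs := (isTraceClass_iff.1 hT)
  have hsP : Summable fun x => entry P x x := by
    refine Summable.of_norm_bounded (Complex.hasSum_re hs.hasSum).summable fun x => ?_
    have hP0 := (Complex.nonneg_iff.1 (entry_diag_nonneg hP x)).1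
    rw [entry_diag_eq_ofReal hP x, Complex.norm_real, Real.norm_of_nonneg hP0, habs, entry_add,
      Complex.add_re]
    linarith [(Complex.nonneg_iff.1 (entry_diag_nonneg hN x)).1]
  have hsN : Summable fun x => entry N x x := by
    simpa [habs, entry_add] using hs.sub hsP
  obtain ⟨v, hv⟩ := exists_isEnsemble hP hsP
  obtain ⟨w, hw⟩ := exists_isEnsemble hN hsN
  have h1 : X ∘L T = X ∘L P - X ∘L N := by rw [hPN, ContinuousLinearMap.comp_sub]
  rw [h1, trace_sub (hv.summable_entry_comp X) (hw.summable_entry_comp X), toReal_traceNorm T hT,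
    habs, trace_add hsP hsN, Complex.add_re, mul_add]
  exact (norm_sub_le _ _).trans (add_le_add (hv.norm_trace_le X) (hw.norm_trace_le X))

theorem IsEnsemble.norm_le {ι κ : Type} {v : κ → L2 ι} {W : Op ι} (h : IsEnsemble v W) :
    ‖W‖ ≤ (trace W).re := by
  have h0 : 0 ≤ (trace W).re := h.hasSum_norm_sq.nonneg fun _ => by positivity
  refine ContinuousLinearMap.opNorm_le_of_re_inner_le h0 fun y x hy hx => ?_
  -- The trace of `|y⟩⟨x| W` is `⟨x|W|y⟩`.
  have h1 : trace (InnerProductSpace.rankOne ℂ y x ∘L W) = inner ℂ x (W y) := by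
    have := ((hasSum_smul_ket y).mapL W).mapL (innerSL ℂ x)
    refine Eq.trans (tsum_congr fun i => ?_) this.tsum_eq
    simp [entry_comp, mul_comm]
  have h2 := h.norm_trace_le (InnerProductSpace.rankOne ℂ y x)
  rw [h1, InnerProductSpace.norm_rankOne, hx, hy, mul_one, one_mul, norm_inner_symm] at h2
  exact (Complex.re_le_norm _).trans h2

theorem norm_le_traceNorm {ι : Type} {T : Op ι} (hT : IsTraceClass T) :
    ‖T‖ ≤ (traceNorm T).toReal := by
  obtain ⟨v, hv⟩ := exists_isEnsemble (opAbs_nonneg T) (isTraceClass_iff.1 hT)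
  rw [toReal_traceNorm T hT, ← norm_opAbs]
  exact hv.norm_le

theorem proj_nonneg {ι : Type} (ψ : L2 ι) : 0 ≤ proj ψ :=
  (ContinuousLinearMap.nonneg_iff_isPositive _).2 (InnerProductSpace.isPositive_rankOne_self ψ)

theorem isEnsemble_proj {ι : Type} (ψ : L2 ι) : IsEnsemble (fun _ : Unit => ψ) (proj ψ) where
  summable := Summable.of_finite
  hasSum x y := by
    rw [entry_proj]
    exact hasSum_unique _

theorem trace_comp_proj {ι : Type} (X : Op ι) (ψ : L2 ι) :
    trace (X ∘L proj ψ) = inner ℂ ψ (X ψ) :=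
  ((isEnsemble_proj ψ).hasSum_trace X).unique (hasSum_unique _)

theorem trace_proj {ι : Type} (ψ : L2 ι) : trace (proj ψ) = (‖ψ‖ ^ 2 : ℝ) := by
  have h : trace (proj ψ) = inner ℂ ψ ψ := trace_comp_proj (1 : Op ι) ψ
  simpa [inner_self_eq_norm_sq_to_K] using h

theorem isTraceClass_proj {ι : Type} (ψ : L2 ι) : IsTraceClass (proj ψ) :=
  (isEnsemble_proj ψ).isTraceClass (proj_nonneg ψ)

theorem norm_sq_tensorVec {a b : Type} (ψ : L2 a) (φ : L2 b) :
    ‖tensorVec ψ φ‖ ^ 2 = ‖ψ‖ ^ 2 * ‖φ‖ ^ 2 := by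
  rw [← tsum_row, norm_sq_eq ψ, ← tsum_mul_right]
  refine tsum_congr fun i => ?_
  have : row (tensorVec ψ φ) i = ψ i • φ := by ext; rfl
  rw [this, norm_smul, mul_pow]

theorem tensorVec_smul_smul {a b : Type} (c d : ℂ) (ψ : L2 a) (φ : L2 b) :
    tensorVec (c • ψ) (d • φ) = (c * d) • tensorVec ψ φ := by
  ext p
  change (c * ψ p.1) * (d * φ p.2) = (c * d) * (ψ p.1 * φ p.2)
  ring

theorem proj_smul {ι : Type} (c : ℂ) (ψ : L2 ι) : proj (c • ψ) = (‖c‖ ^ 2 : ℝ) • proj ψ := by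
  refine ext_entry fun x y => ?_
  rw [entry_real_smul, entry_proj, entry_proj]
  change c * ψ x * conj (c * ψ y) = _
  rw [map_mul, mul_mul_mul_comm, Complex.mul_conj, Complex.normSq_eq_norm_sq]

/-! ### Truncation and partial transposition -/

theorem norm_sum_smul_ket_le {ι : Type} (s : Finset ι) (f : L2 ι) :
    ‖∑ x ∈ s, f x • ket x‖ ≤ ‖f‖ := by
  classical
  rw [← sq_le_sq₀ (norm_nonneg _) (norm_nonneg _), norm_sq_eq, norm_sq_eq]
  refine (summable_sq _).tsum_le_tsum (fun y => ?_) (summable_sq f)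
  have : (∑ x ∈ s, f x • (ket x : L2 ι)) y = if y ∈ s then f y else 0 := by
    rw [lp.coeFn_sum]
    simp [ket_apply]
  rw [this]
  split_ifs
  · exact le_rfl
  · simp

theorem inner_sum_smul_ket {ι : Type} (s : Finset ι) (f : L2 ι) (X : Op ι) :
    inner ℂ (∑ x ∈ s, f x • ket x) (X (∑ x ∈ s, f x • ket x)) =
      ∑ x ∈ s, ∑ y ∈ s, entry X x y * (f y * conj (f x)) := by
  rw [map_sum, sum_inner]
  refine Finset.sum_congr rfl fun x _ => ?_
  rw [inner_sum]
  refine Finset.sum_congr rfl fun y _ => ?_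
  rw [map_smul, inner_smul_left, inner_smul_right, entry]
  ring

/-- `Tr X W` is the limit of the traces of the finite truncations of `X` and `W`. -/
theorem IsEnsemble.tendsto_sum {ι κ : Type} {v : κ → L2 ι} {W : Op ι}
    (h : IsEnsemble v W) (X : Op ι) :
    Tendsto (fun s : Finset ι => ∑ x ∈ s, ∑ y ∈ s, entry X x y * entry W y x) atTop
      (𝓝 (trace (X ∘L W))) := by
  have h1 : ∀ s : Finset ι, ∑ x ∈ s, ∑ y ∈ s, entry X x y * entry W y x =
      ∑' k, inner ℂ (∑ x ∈ s, v k x • ket x) (X (∑ x ∈ s, v k x • ket x)) := fun s => by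
    simp only [inner_sum_smul_ket]
    exact (hasSum_sum fun x _ => hasSum_sum fun y _ => (h.hasSum y x).mul_left _).tsum_eq.symm
  simp only [h1]
  rw [← (h.hasSum_trace X).tsum_eq]
  refine tendsto_tsum_of_dominated_convergence (h.summable.mul_left ‖X‖) (fun k => ?_)
    (Eventually.of_forall fun s k => ?_)
  · have hk : Tendsto (fun s : Finset ι => ∑ x ∈ s, v k x • ket x) atTop (𝓝 (v k)) :=
      hasSum_smul_ket (v k)
    exact hk.inner ((X.continuous.tendsto _).comp hk)
  · refine (norm_inner_le_norm _ _).trans ?_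
    have hs := norm_sum_smul_ket_le s (v k)
    calc _ ≤ ‖v k‖ * (‖X‖ * ‖v k‖) := by
          gcongr
          exact (X.le_opNorm _).trans (by gcongr)
      _ = ‖X‖ * ‖v k‖ ^ 2 := by ring

/-- Partial transposition does not change `Tr X W`. The double sum over the matrix elements need
not converge absolutely, so that the exchange of the indices is done in the truncations. -/
theorem trace_comp_eq_of_isPartialTranspose {a b κ μ : Type} {X Y W V : Op (a × b)}
    {v : κ → L2 (a × b)} {w : μ → L2 (a × b)} (hv : IsEnsemble v W) (hw : IsEnsemble w V)
    (hXY : IsPartialTranspose X Y) (hWV : IsPartialTranspose W V) :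
    trace (X ∘L W) = trace (Y ∘L V) := by
  classical
  have hp := tendsto_finsetProd_atTop (ι := a) (ι' := b)
  refine tendsto_nhds_unique ((hv.tendsto_sum X).comp hp)
    (((hw.tendsto_sum Y).comp hp).congr fun s => ?_)
  simp only [Function.comp_apply, Finset.sum_product]
  refine Finset.sum_congr rfl fun i _ => ?_
  simp_rw [Finset.sum_comm (s := s.2) (t := s.1)]
  refine Finset.sum_congr rfl fun i' _ => ?_
  rw [Finset.sum_comm]
  refine Finset.sum_congr rfl fun j _ => Finset.sum_congr rfl fun j' _ => ?_
  rw [hXY i i' j' j, hWV i' i j j']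

/-- `|Tr X W| = |Tr X^Γ W^Γ| ≤ ‖X^Γ‖ Tr W^Γ ≤ Tr W`. -/
theorem norm_trace_le_of_mem_pptCone {a b : Type} {X Y W : Op (a × b)}
    (hXY : IsPartialTranspose X Y) (hY : ‖Y‖ ≤ 1) (hW : W ∈ pptCone a b) :
    ‖trace (X ∘L W)‖ ≤ (trace W).re := by
  obtain ⟨htc, h0, V, hWV, hV⟩ := hW
  obtain ⟨v, hv⟩ := htc.exists_isEnsemble h0
  have hdiag : ∀ x, entry V x x = entry W x x := fun x => hWV x.1 x.1 x.2 x.2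
  have htr : trace V = trace W := tsum_congr hdiag
  obtain ⟨w, hw⟩ := exists_isEnsemble hV (by simpa only [hdiag] using hv.summable_entry)
  rw [trace_comp_eq_of_isPartialTranspose hv hw hXY hWV, ← htr]
  refine (hw.norm_trace_le Y).trans ?_
  have : 0 ≤ (trace V).re := hw.hasSum_norm_sq.nonneg fun _ => by positivity
  exact mul_le_of_le_one_left this hY

/-- The entrywise complex conjugate of a vector. -/
noncomputable def conjVec {ι : Type} (f : L2 ι) : L2 ι :=
  ⟨fun i => conj (f i), memℓp_of_sq (by simpa using summable_sq f)⟩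

theorem conjVec_apply {ι : Type} (f : L2 ι) (i : ι) : conjVec f i = conj (f i) := rfl

theorem tensorVec_apply {a b : Type} (ψ : L2 a) (φ : L2 b) (p : a × b) :
    tensorVec ψ φ p = ψ p.1 * φ p.2 := rfl

theorem isPartialTranspose_proj_tensorVec {a b : Type} (ψ : L2 a) (φ : L2 b) :
    IsPartialTranspose (proj (tensorVec ψ φ)) (proj (tensorVec ψ (conjVec φ))) := by
  intro i i' j j'
  simp only [entry_proj, tensorVec_apply, conjVec_apply, map_mul, Complex.conj_conj]
  ring

theorem proj_tensorVec_mem_pptCone {a b : Type} (ψ : L2 a) (φ : L2 b) :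
    proj (tensorVec ψ φ) ∈ pptCone a b :=
  ⟨isTraceClass_proj _, proj_nonneg _, _, isPartialTranspose_proj_tensorVec ψ φ, proj_nonneg _⟩

/-! ### The separable cone -/

theorem traceNorm_zero {ι : Type} : traceNorm (0 : Op ι) = 0 := by
  simp [traceNorm, opAbs_of_nonneg (le_refl (0 : Op ι)), entry]

theorem mem_separableStates_of_product {a b : Type} {ψ : L2 a} {φ : L2 b} (hψ : ‖ψ‖ = 1)
    (hφ : ‖φ‖ = 1) : proj (tensorVec ψ φ) ∈ separableStates a b :=
  ⟨isTraceClass_proj _, fun ε hε => ⟨proj (tensorVec ψ φ),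
    subset_convexHull ℝ _ ⟨ψ, φ, hψ, hφ, rfl⟩, by rwa [sub_self, traceNorm_zero]⟩⟩

theorem proj_zero {ι : Type} : proj (0 : L2 ι) = 0 := by simp [proj]

theorem exists_unit_smul {ι : Type} {ψ : L2 ι} (hψ : ψ ≠ 0) :
    ∃ ψ' : L2 ι, ‖ψ'‖ = 1 ∧ ψ = (‖ψ‖ : ℂ) • ψ' := by
  have h : (‖ψ‖ : ℂ) ≠ 0 := by simpa using hψ
  exact ⟨(‖ψ‖ : ℂ)⁻¹ • ψ, by simp [norm_smul, hψ], by rw [smul_inv_smul₀ h]⟩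

/-- The index sets are nonempty because on the zero space there are no product states, and the
separable cone is empty. -/
theorem proj_tensorVec_mem_separableCone {a b : Type} [Nonempty a] [Nonempty b]
    (ψ : L2 a) (φ : L2 b) :
    proj (tensorVec ψ φ) ∈ separableCone a b := by
  by_cases h : ψ = 0 ∨ φ = 0
  · obtain ⟨i⟩ := ‹Nonempty a›
    obtain ⟨j⟩ := ‹Nonempty b›
    refine ⟨0, le_rfl, _, mem_separableStates_of_product (norm_ket i) (norm_ket j), ?_⟩
    have : tensorVec ψ φ = 0 := by
      ext p
      rw [tensorVec_apply]
      rcases h with rfl | rfl <;> simp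
    rw [this, proj_zero, zero_smul]
  · push Not at h
    obtain ⟨ψ', hψ', hψ⟩ := exists_unit_smul h.1
    obtain ⟨φ', hφ', hφ⟩ := exists_unit_smul h.2
    refine ⟨(‖ψ‖ * ‖φ‖) ^ 2, by positivity, _, mem_separableStates_of_product hψ' hφ', ?_⟩
    conv_lhs => rw [hψ, hφ, tensorVec_smul_smul, proj_smul]
    simp

/-- The inequality holds for product vectors by assumption and is preserved by convex combinations
and by limits in trace norm. -/
theorem norm_trace_le_of_mem_separableStates {a b : Type} {X σ : Op (a × b)}
    (hX : ∀ (ψ : L2 a) (φ : L2 b), ‖ψ‖ = 1 → ‖φ‖ = 1 →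
      ‖inner ℂ (tensorVec ψ φ) (X (tensorVec ψ φ))‖ ≤ 1) (hσ : σ ∈ separableStates a b) :
    ‖trace (X ∘L σ)‖ ≤ (trace σ).re := by
  have hhull : convexHull ℝ (pureProductStates a b) ⊆
      {τ | 0 ≤ τ ∧ IsTraceClass τ ∧ ‖trace (X ∘L τ)‖ ≤ (trace τ).re} := by
    refine convexHull_min ?_ ?_
    · rintro _ ⟨ψ, φ, hψ, hφ, rfl⟩
      refine ⟨proj_nonneg _, isTraceClass_proj _, ?_⟩
      rw [trace_comp_proj, trace_proj, norm_sq_tensorVec, hψ, hφ]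
      simpa using hX ψ φ hψ hφ
    · rintro S ⟨hS0, hS1, hS⟩ T ⟨hT0, hT1, hT⟩ s t hs ht -
      obtain ⟨v, hv⟩ := hS1.exists_isEnsemble hS0
      obtain ⟨w, hw⟩ := hT1.exists_isEnsemble hT0
      have h0 : 0 ≤ s • S + t • T :=
        add_nonneg (real_smul_nonneg_op hs hS0) (real_smul_nonneg_op ht hT0)
      have hsm : ∀ (c : ℝ) (Z : Op (a × b)), (Summable fun x => entry Z x x) →
          Summable fun x => entry (c • Z) x x := fun c Z hZ => by
        simpa only [entry_real_smul] using hZ.mul_left (c : ℂ)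
      refine ⟨h0, (isTraceClass_iff_of_nonneg h0).2 ?_, ?_⟩
      · simpa only [entry_add] using (hsm s S hv.summable_entry).add (hsm t T hw.summable_entry)
      · have e : X ∘L (s • S + t • T) = s • (X ∘L S) + t • (X ∘L T) := by
          ext; simp
        rw [e, trace_add (hsm _ _ (hv.summable_entry_comp X)) (hsm _ _ (hw.summable_entry_comp X)),
          trace_add (hsm _ _ hv.summable_entry) (hsm _ _ hw.summable_entry)]
        simp only [trace_real_smul, Complex.add_re, Complex.re_ofReal_mul]
        refine (norm_add_le _ _).trans ?_
        rw [norm_mul, norm_mul, Complex.norm_real, Complex.norm_real, Real.norm_of_nonneg hs,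
          Real.norm_of_nonneg ht]
        gcongr
  have happrox : ∀ ε : ℝ, 0 < ε → ∃ τ, 0 ≤ τ ∧ IsTraceClass τ ∧
      ‖trace (X ∘L τ)‖ ≤ (trace τ).re ∧ IsTraceClass (σ - τ) ∧
      (traceNorm (σ - τ)).toReal < ε := fun ε hε => by
    obtain ⟨τ, hτ, hlt⟩ := hσ.2 (ENNReal.ofReal ε) (ENNReal.ofReal_pos.2 hε)
    have htop : traceNorm (σ - τ) < ∞ := hlt.trans ENNReal.ofReal_lt_top
    obtain ⟨h1, h2, h3⟩ := hhull hτ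
    exact ⟨τ, h1, h2, h3, htop, (ENNReal.lt_ofReal_iff_toReal_lt htop.ne).1 hlt⟩
  -- The trace norm dominates the operator norm, so `σ` is a norm limit of positive operators.
  have hσ0 : 0 ≤ σ := by
    refine isClosed_nonneg_op.closure_subset (Metric.mem_closure_iff.2 fun ε hε => ?_)
    obtain ⟨τ, h0, -, -, htc, hlt⟩ := happrox ε hε
    exact ⟨τ, h0, by rw [dist_eq_norm]; exact (norm_le_traceNorm htc).trans_lt hlt⟩
  refine le_of_forall_pos_le_add fun δ hδ => ?_
  obtain ⟨τ, h0, h1, hle, htc, hlt⟩ := happrox (δ / (‖X‖ + 1)) (by positivity)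
  obtain ⟨v, hv⟩ := hσ.1.exists_isEnsemble hσ0
  obtain ⟨w, hw⟩ := h1.exists_isEnsemble h0
  have hsa : IsSelfAdjoint (σ - τ) := (IsSelfAdjoint.of_nonneg hσ0).sub (IsSelfAdjoint.of_nonneg h0)
  have hX' := norm_trace_comp_le htc hsa X
  have h1' : ‖trace (σ - τ)‖ ≤ (traceNorm (σ - τ)).toReal :=
    (norm_trace_comp_le htc hsa (1 : Op (a × b))).trans
      (mul_le_of_le_one_left ENNReal.toReal_nonneg ContinuousLinearMap.norm_id_le)
  rw [ContinuousLinearMap.comp_sub, trace_sub (hv.summable_entry_comp X)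
    (hw.summable_entry_comp X)] at hX'
  rw [trace_sub hv.summable_entry hw.summable_entry] at h1'
  have h2 := norm_le_norm_add_norm_sub' (trace (X ∘L σ)) (trace (X ∘L τ))
  have h3 := (Complex.abs_re_le_norm _).trans h1'
  rw [Complex.sub_re] at h3
  have h4 := (abs_le.1 h3).1
  have h5 : (‖X‖ + 1) * (traceNorm (σ - τ)).toReal ≤ δ := by
    rw [lt_div_iff₀ (by positivity)] at hlt
    linarith
  linarith

theorem norm_trace_le_of_mem_separableCone {a b : Type} {X W : Op (a × b)}
    (hX : ∀ (ψ : L2 a) (φ : L2 b), ‖ψ‖ = 1 → ‖φ‖ = 1 →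
      ‖inner ℂ (tensorVec ψ φ) (X (tensorVec ψ φ))‖ ≤ 1) (hW : W ∈ separableCone a b) :
    ‖trace (X ∘L W)‖ ≤ (trace W).re := by
  obtain ⟨c, hc, σ, hσ, rfl⟩ := hW
  have e : X ∘L (c • σ) = c • (X ∘L σ) := by ext; simp
  rw [e, trace_real_smul, trace_real_smul, Complex.re_ofReal_mul, norm_mul, Complex.norm_real,
    Real.norm_of_nonneg hc]
  gcongr
  exact norm_trace_le_of_mem_separableStates hX hσ

/-- If the partial transpose of the self-adjoint operator `X` is a contraction, then `X` belongs to
the dual operator interval of either cone. -/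
theorem mem_dualInterval_of_isPartialTranspose (K : ConeKind) {a b : Type} {X Y : Op (a × b)}
    (hX : IsSelfAdjoint X) (hXY : IsPartialTranspose X Y) (hY : ‖Y‖ ≤ 1) :
    X ∈ dualInterval K a b := by
  refine ⟨hX, fun W hW => ?_⟩
  cases K with
  | ppt => exact norm_trace_le_of_mem_pptCone hXY hY hW
  | sep =>
    refine norm_trace_le_of_mem_separableCone (fun ψ φ hψ hφ => ?_) hW
    have h := norm_trace_le_of_mem_pptCone hXY hY (proj_tensorVec_mem_pptCone ψ φ)
    rw [trace_comp_proj, trace_proj, norm_sq_tensorVec, hψ, hφ] at h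
    simpa using h

/-! ### Tensor powers -/

theorem tensorVec_ket {a b : Type} (i : a) (j : b) :
    tensorVec (ket i) (ket j) = ket (i, j) := by
  classical
  ext p
  rw [tensorVec_apply, ket_apply, ket_apply, ket_apply]
  by_cases h1 : p.1 = i <;> by_cases h2 : p.2 = j <;> simp [h1, h2, Prod.ext_iff]

theorem idTensor_tensorVec {a b b' : Type} (B : L2 b →L[ℂ] L2 b') (ψ : L2 a) (φ : L2 b) :
    idTensor a B (tensorVec ψ φ) = tensorVec ψ (B φ) := by
  ext p
  change B (row (tensorVec ψ φ) p.1) p.2 = ψ p.1 * B φ p.2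
  have : row (tensorVec ψ φ) p.1 = ψ p.1 • φ := by ext; rfl
  rw [this, map_smul]
  rfl

theorem reindex_prodComm_tensorVec {a b : Type} (ψ : L2 a) (φ : L2 b) :
    reindex (Equiv.prodComm a b) (tensorVec ψ φ) = tensorVec φ ψ := by
  ext p
  exact mul_comm _ _

theorem opTensor_tensorVec {a a' b b' : Type} (A : L2 a →L[ℂ] L2 a') (B : L2 b →L[ℂ] L2 b')
    (ψ : L2 a) (φ : L2 b) : opTensor A B (tensorVec ψ φ) = tensorVec (A ψ) (B φ) := by
  change reindex _ (idTensor b' A (reindex _ (idTensor a B (tensorVec ψ φ)))) = _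
  rw [idTensor_tensorVec, reindex_prodComm_tensorVec, idTensor_tensorVec,
    reindex_prodComm_tensorVec]

theorem opTensor_comp {a b : Type} (A A' : Op a) (B B' : Op b) :
    opTensor (A ∘L A') (B ∘L B') = opTensor A B ∘L opTensor A' B' := by
  refine ext_entry fun x y => ?_
  rw [entry_eq, entry_eq, ← Prod.mk.eta (p := y), ← tensorVec_ket]
  change _ = opTensor A B (opTensor A' B' _) x
  simp only [opTensor_tensorVec]
  rfl

theorem conjReindex_comp {ι κ : Type} (e : ι ≃ κ) (S T : Op ι) :
    conjReindex e (S ∘L T) = conjReindex e S ∘L conjReindex e T := by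
  ext1 f
  change reindex e (S (T (reindex e.symm f))) =
    reindex e (S (reindex e.symm (reindex e (T (reindex e.symm f)))))
  have : ∀ g : L2 ι, reindex e.symm (reindex e g) = g := fun g => by
    ext i
    change g (e.symm (e.symm.symm i)) = g i
    simp
  rw [this]

theorem opPow_comp {ι : Type} (S T : Op ι) (n : ℕ) :
    opPow (S ∘L T) n = opPow S n ∘L opPow T n := by
  induction n with
  | zero => rfl
  | succ n ih => rw [opPow, opPow, opPow, ih, opTensor_comp, conjReindex_comp]

theorem copies_comp {a b : Type} (S T : Op (a × b)) (n : ℕ) :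
    copies (S ∘L T) n = copies S n ∘L copies T n := by
  rw [copies, opPow_comp, conjReindex_comp]; rfl

theorem isSelfAdjoint_copies {a b : Type} {X : Op (a × b)} (hX : IsSelfAdjoint X) (n : ℕ) :
    IsSelfAdjoint (copies X n) := by
  rw [isSelfAdjoint_iff_entry] at hX ⊢
  intro x y
  simp only [entry_copies, map_prod, hX]

theorem isPartialTranspose_copies {a b : Type} {X Y : Op (a × b)} (h : IsPartialTranspose X Y)
    (n : ℕ) : IsPartialTranspose (copies X n) (copies Y n) := fun x x' y y' => by
  simp only [entry_copies]
  exact Finset.prod_congr rfl fun k _ => h _ _ _ _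

/-- If `S` is a self-adjoint square root of `W`, then `S^{⊗n}` is one of `W^{⊗n}`. -/
theorem copies_nonneg {a b : Type} {W : Op (a × b)} (hW : 0 ≤ W) (n : ℕ) : 0 ≤ copies W n := by
  obtain ⟨S, hsym, hSW⟩ := exists_symmetric_sqrt hW
  have hS : IsSelfAdjoint S := ContinuousLinearMap.isSelfAdjoint_iff_isSymmetric.2 hsym
  have hW' : W = S ∘L S := by ext1 f; exact (hSW f).symm
  have h := ContinuousLinearMap.isPositive_adjoint_comp_self (copies S n)
  rw [ContinuousLinearMap.isSelfAdjoint_iff'.1 (isSelfAdjoint_copies hS n), ← copies_comp,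
    ← hW'] at h
  exact (ContinuousLinearMap.nonneg_iff_isPositive _).2 h

theorem norm_idTensor_le (a : Type) {b b' : Type} (B : L2 b →L[ℂ] L2 b') : ‖idTensor a B‖ ≤ ‖B‖ :=
  LinearMap.mkContinuous_norm_le _ (norm_nonneg _) _

theorem norm_idTensor_apply_le (a : Type) {b b' : Type} (B : L2 b →L[ℂ] L2 b') (f : L2 (a × b)) :
    ‖idTensor a B f‖ ≤ ‖B‖ * ‖f‖ :=
  (idTensor a B).le_of_opNorm_le (norm_idTensor_le a B) f

theorem norm_opTensor_le {a a' b b' : Type} (A : L2 a →L[ℂ] L2 a') (B : L2 b →L[ℂ] L2 b') :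
    ‖opTensor A B‖ ≤ ‖A‖ * ‖B‖ := by
  refine ContinuousLinearMap.opNorm_le_bound _ (by positivity) fun f => ?_
  change ‖reindex _ (idTensor b' A (reindex _ (idTensor a B f)))‖ ≤ _
  rw [LinearIsometryEquiv.norm_map, mul_assoc]
  refine (norm_idTensor_apply_le _ _ _).trans ?_
  rw [LinearIsometryEquiv.norm_map]
  gcongr
  exact norm_idTensor_apply_le _ _ _

theorem norm_conjReindex_le {ι κ : Type} (e : ι ≃ κ) (T : Op ι) : ‖conjReindex e T‖ ≤ ‖T‖ := by
  refine ContinuousLinearMap.opNorm_le_bound _ (by positivity) fun f => ?_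
  change ‖reindex e (T (reindex e.symm f))‖ ≤ _
  rw [LinearIsometryEquiv.norm_map, ← LinearIsometryEquiv.norm_map (reindex e.symm) f]
  exact T.le_opNorm _

theorem norm_copies_le {a b : Type} (T : Op (a × b)) (n : ℕ) : ‖copies T n‖ ≤ ‖T‖ ^ n := by
  refine (norm_conjReindex_le _ _).trans ?_
  induction n with
  | zero => exact ContinuousLinearMap.norm_id_le
  | succ n ih =>
    refine (norm_conjReindex_le _ _).trans ((norm_opTensor_le _ _).trans ?_)
    rw [pow_succ']
    gcongr

theorem hasSum_mul_prod {α β : Type*} {f : α → ℂ} {g : β → ℂ} {s t : ℂ} (hf : HasSum f s)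
    (hg : HasSum g t) : HasSum (fun p : α × β => f p.1 * g p.2) (s * t) :=
  hf.mul hg (summable_mul_of_summable_norm (f := f) (g := g) hf.summable.norm hg.summable.norm)

theorem hasSum_entry_opPow {ι : Type} {T : Op ι} (h : Summable fun x => entry T x x) (n : ℕ) :
    HasSum (fun x => entry (opPow T n) x x) (trace T ^ n) := by
  induction n with
  | zero =>
    have : ∀ x : Fin 0 → ι, entry (opPow T 0) x x = 1 := fun x => by
      classical
      simp [opPow, entry_eq, ket_apply]
    simp only [this, pow_zero]
    exact hasSum_unique _
  | succ n ih =>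
    have h1 : HasSum _ (trace T * trace T ^ n) := hasSum_mul_prod h.hasSum ih
    rw [pow_succ', ← Equiv.hasSum_iff (Fin.consEquiv fun _ : Fin (n + 1) => ι)]
    convert h1 using 1
    funext x
    simp only [Function.comp_apply, opPow, entry_conjReindex, Equiv.symm_apply_apply,
      entry_opTensor]

theorem hasSum_entry_copies {a b : Type} {T : Op (a × b)} (h : Summable fun x => entry T x x)
    (n : ℕ) : HasSum (fun x => entry (copies T n) x x) (trace T ^ n) := by
  refine (Equiv.hasSum_iff (Equiv.arrowProdEquivProdArrow (Fin n) (fun _ => a) (fun _ => b))).1 ?_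
  convert hasSum_entry_opPow h n using 1
  funext x
  simp only [Function.comp_apply, copies, entry_conjReindex, Equiv.symm_apply_apply]

/-- Tensor powers of states are states. -/
theorem isState_copies {a b : Type} {ρ : Op (a × b)} (hρ : IsState ρ) (n : ℕ) :
    IsState (copies ρ n) where
  nonneg := copies_nonneg hρ.nonneg n
  traceClass := (isTraceClass_iff_of_nonneg (copies_nonneg hρ.nonneg n)).2
    (hasSum_entry_copies ((isTraceClass_iff_of_nonneg hρ.nonneg).1 hρ.traceClass) n).summable
  trace_eq_one := by
    rw [trace, (hasSum_entry_copies
      ((isTraceClass_iff_of_nonneg hρ.nonneg).1 hρ.traceClass) n).tsum_eq, hρ.trace_eq_one, one_pow]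

theorem IsState.norm_trace_comp_le {ι : Type} {ρ : Op ι} (hρ : IsState ρ) (X : Op ι) :
    ‖trace (X ∘L ρ)‖ ≤ ‖X‖ := by
  obtain ⟨v, hv⟩ := hρ.traceClass.exists_isEnsemble hρ.nonneg
  simpa [hρ.trace_eq_one] using hv.norm_trace_le X

theorem IsState.trace_comp_copies {a b : Type} {ρ : Op (a × b)} (hρ : IsState ρ)
    (X : Op (a × b)) (n : ℕ) : trace (copies X n ∘L copies ρ n) = trace (X ∘L ρ) ^ n := by
  obtain ⟨v, hv⟩ := hρ.traceClass.exists_isEnsemble hρ.nonneg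
  rw [← copies_comp, trace, (hasSum_entry_copies (hv.summable_entry_comp X) n).tsum_eq]

/-! ### Operations on product vectors -/

/-- Every `X` in the dual operator interval of the cone `K` of the output system satisfies
`|Tr X Λ(P)| ≤ Tr P` for all multiples `P` of pure product states. This is the only property of
`K`-preserving and LOCC operations, beyond those built into `PTPMap`, on which the lower bounds on
the entanglement cost rely. -/
def BoundedOnProducts (K : ConeKind) {a b a' b' : Type} (Λ : PTPMap (a × b) (a' × b')) : Prop :=
  ∀ X ∈ dualInterval K a' b', ∀ (ψ : L2 a) (φ : L2 b),
    ‖trace (X ∘L Λ.toFun (proj (tensorVec ψ φ)))‖ ≤ ‖ψ‖ ^ 2 * ‖φ‖ ^ 2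

theorem proj_tensorVec_mem_cone (K : ConeKind) {a b : Type} [Nonempty a] [Nonempty b]
    (ψ : L2 a) (φ : L2 b) : proj (tensorVec ψ φ) ∈ cone K a b := by
  cases K with
  | sep => exact proj_tensorVec_mem_separableCone ψ φ
  | ppt => exact proj_tensorVec_mem_pptCone ψ φ

theorem re_trace_proj_tensorVec {a b : Type} (ψ : L2 a) (φ : L2 b) :
    (trace (proj (tensorVec ψ φ))).re = ‖ψ‖ ^ 2 * ‖φ‖ ^ 2 := by
  rw [trace_proj, norm_sq_tensorVec, Complex.ofReal_re]

theorem boundedOnProducts_of_mem_preserving {K : ConeKind} {a b a' b' : Type} [Nonempty a]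
    [Nonempty b] {Λ : PTPMap (a × b) (a' × b')} (hΛ : Λ ∈ preserving K a b a' b') :
    BoundedOnProducts K Λ := fun X hX ψ φ => by
  refine (hX.2 _ (hΛ _ (proj_tensorVec_mem_cone K ψ φ))).trans ?_
  rw [Λ.trace_eq _ (isTraceClass_proj _), re_trace_proj_tensorVec]

/-- If `W = ∑ₖ |v k⟩⟨v k|` in the sense of matrix elements, then `∑ₖ ‖v k‖²` converges as soon as
the diagonal of `W` is summable, by exchanging two sums of nonnegative terms. -/
theorem isEnsemble_of_summable {ι κ : Type} {v : κ → L2 ι} {W : Op ι}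
    (h : ∀ x y, HasSum (fun k => v k x * conj (v k y)) (entry W x y))
    (hW : Summable fun x => entry W x x) : IsEnsemble v W where
  hasSum := h
  summable := by
    have hx : ∀ x, HasSum (fun k => ‖v k x‖ ^ 2) (entry W x x).re := fun x => by
      convert Complex.hasSum_re (h x x) using 2 with k
      rw [Complex.mul_conj, Complex.normSq_eq_norm_sq, Complex.ofReal_re]
    have hp : Summable fun p : ι × κ => ‖v p.2 p.1‖ ^ 2 := by
      refine (summable_prod_of_nonneg fun _ => by positivity).2 ⟨fun x => (hx x).summable, ?_⟩
      simp only [(hx _).tsum_eq]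
      exact (Complex.hasSum_re hW.hasSum).summable
    simp only [norm_sq_eq]
    exact hp.prod_symm.prod

theorem entry_conj_proj {ι κ : Type} (M : L2 ι →L[ℂ] L2 κ) (ψ : L2 ι) (x y : κ) :
    entry (M ∘L proj ψ ∘L ContinuousLinearMap.adjoint M) x y = M ψ x * conj (M ψ y) := by
  rw [entry_eq]
  change M (proj ψ (ContinuousLinearMap.adjoint M (ket y))) x = _
  rw [proj, InnerProductSpace.rankOne_apply, map_smul, ContinuousLinearMap.adjoint_inner_right,
    ← inner_conj_symm, inner_ket]
  exact mul_comm _ _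

/-- The Kraus operators of an LOCC operation map product vectors to product vectors. -/
theorem boundedOnProducts_of_mem_locc {a b a' b' : Type} [Nonempty a'] [Nonempty b']
    {Λ : PTPMap (a × b) (a' × b')} (hΛ : Λ ∈ locc a b a' b') : BoundedOnProducts .sep Λ := by
  obtain ⟨κ, M, -, hM⟩ := hΛ
  intro X hX ψ φ
  have htc := isTraceClass_proj (tensorVec ψ φ)
  have h0 := Λ.nonneg _ htc (proj_nonneg _)
  have hens : IsEnsemble (fun k => tensorVec ((M k).1 ψ) ((M k).2 φ))
      (Λ.toFun (proj (tensorVec ψ φ))) := by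
    refine isEnsemble_of_summable (fun x y => ?_)
      ((isTraceClass_iff_of_nonneg h0).1 (Λ.traceClass _ htc))
    simpa only [entry_conj_proj, opTensor_tensorVec] using hM _ htc x y
  rw [← re_trace_proj_tensorVec, ← Λ.trace_eq _ htc,
    ← one_mul (trace (Λ.toFun (proj (tensorVec ψ φ)))).re]
  refine hens.norm_trace_le_of_forall fun k => ?_
  have h := hX.2 _ (proj_tensorVec_mem_separableCone ((M k).1 ψ) ((M k).2 φ))
  rw [trace_comp_proj, re_trace_proj_tensorVec] at h
  rwa [one_mul, norm_sq_tensorVec]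

/-! ### Entanglement bits as combinations of product states -/

theorem PTPMap.map_sum {ι κ : Type} [Finite ι] (Λ : PTPMap ι κ) {μ : Type} (s : Finset μ)
    (T : μ → Op ι) : Λ.toFun (∑ q ∈ s, T q) = ∑ q ∈ s, Λ.toFun (T q) := by
  classical
  induction s using Finset.induction_on with
  | empty =>
    simpa using Λ.map_smul 0 0 (isTraceClass_of_finite _)
  | insert q s hq ih =>
    rw [Finset.sum_insert hq, Finset.sum_insert hq,
      Λ.map_add _ _ (isTraceClass_of_finite _) (isTraceClass_of_finite _), ih]

theorem PTPMap.trace_comp_sum {ι κ : Type} [Finite ι] (Λ : PTPMap ι κ) (X : Op κ) {μ : Type}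
    (s : Finset μ) (c : μ → ℂ) (ψ : μ → L2 ι) :
    trace (X ∘L Λ.toFun (∑ q ∈ s, c q • proj (ψ q))) =
      ∑ q ∈ s, c q * trace (X ∘L Λ.toFun (proj (ψ q))) := by
  have hsum : ∀ q, Summable fun x => entry (X ∘L Λ.toFun (proj (ψ q))) x x := fun q => by
    have htc := isTraceClass_proj (ψ q)
    obtain ⟨v, hv⟩ := (Λ.traceClass _ htc).exists_isEnsemble (Λ.nonneg _ htc (proj_nonneg _))
    exact hv.summable_entry_comp X
  have e : X ∘L Λ.toFun (∑ q ∈ s, c q • proj (ψ q)) =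
      ∑ q ∈ s, c q • (X ∘L Λ.toFun (proj (ψ q))) := by
    rw [Λ.map_sum]
    ext1 f
    simp [Λ.map_smul _ _ (isTraceClass_of_finite _)]
  have he : ∀ x, entry (∑ q ∈ s, c q • (X ∘L Λ.toFun (proj (ψ q)))) x x =
      ∑ q ∈ s, c q * entry (X ∘L Λ.toFun (proj (ψ q))) x x := fun x => by
    simp only [← entry_smul]
    simp [entry]
  rw [e, trace]
  simp only [he]
  exact (hasSum_sum fun q _ => (hsum q).hasSum.mul_left _).tsum_eq

/-- For `c` running over the fourth roots of unity, the means of `c` and of `c²` vanish, so that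
only the terms with `c * conj c = 1` survive. -/
theorem polarization (p q r w : ℂ) :
    ∑ k : Fin 4, Complex.I ^ (k : ℕ) *
      ((p + Complex.I ^ (k : ℕ) * q) * conj (r + Complex.I ^ (k : ℕ) * w)) = 4 * (p * conj w) := by
  have h2 : Complex.I ^ 2 = -1 := Complex.I_sq
  have h3 : Complex.I ^ 3 = -Complex.I := by rw [pow_succ, h2]; ring
  simp only [Fin.sum_univ_four, map_add, map_mul, map_pow, Complex.conj_I, Fin.val_zero,
    Fin.val_one, Fin.val_two, show ((3 : Fin 4) : ℕ) = 3 from rfl, pow_zero, pow_one, h2, h3]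
  ring_nf
  have h4 : Complex.I ^ 4 = 1 := Complex.I_pow_four
  have h5 : Complex.I ^ 5 = Complex.I := by rw [pow_succ, h4, one_mul]
  simp only [h2, h3, h4, h5]
  ring

/-- The vectors `|s⟩ + iᵏ|t⟩`. -/
noncomputable def phaseVec {ι : Type} (s t : ι) (k : Fin 4) : L2 ι :=
  ket s + Complex.I ^ (k : ℕ) • ket t

theorem norm_sq_phaseVec_le {ι : Type} (s t : ι) (k : Fin 4) : ‖phaseVec s t k‖ ^ 2 ≤ 4 := by
  have h : ‖phaseVec s t k‖ ≤ 2 := by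
    refine (norm_add_le _ _).trans ?_
    rw [norm_smul, norm_pow, Complex.norm_I, one_pow, norm_ket, norm_ket]
    norm_num
  nlinarith [norm_nonneg (phaseVec s t k)]

theorem sum_phaseVec {ι : Type} [DecidableEq ι] (s t x y : ι) :
    ∑ k : Fin 4, Complex.I ^ (k : ℕ) * (phaseVec s t k x * conj (phaseVec s t k y)) =
      4 * ((if x = s then 1 else 0) * (if y = t then 1 else 0)) := by
  refine (polarization ((ket s : L2 ι) x) ((ket t : L2 ι) x) ((ket s : L2 ι) y)
    ((ket t : L2 ι) y)).trans ?_
  rw [ket_apply, ket_apply]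
  split_ifs <;> simp

theorem sum_phases_mul {α β γ δ : Fin 4 → ℂ} {A B : ℂ} (c : ℂ)
    (h1 : ∑ k : Fin 4, Complex.I ^ (k : ℕ) * (α k * β k) = 4 * A)
    (h2 : ∑ k : Fin 4, Complex.I ^ (k : ℕ) * (γ k * δ k) = 4 * B) :
    ∑ q : Fin 4 × Fin 4, c / 16 * (Complex.I ^ (q.1 : ℕ) * Complex.I ^ (q.2 : ℕ)) *
      ((α q.1 * γ q.2) * (β q.1 * δ q.2)) = c * (A * B) := by
  have h := congrArg₂ (· * ·) h1 h2
  simp only [Finset.sum_mul_sum] at h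
  have e : c * (A * B) = c / 16 * (4 * A * (4 * B)) := by ring
  rw [e, ← h, Fintype.sum_prod_type, Finset.mul_sum]
  refine Finset.sum_congr rfl fun k _ => ?_
  rw [Finset.mul_sum]
  exact Finset.sum_congr rfl fun l _ => by ring

theorem entry_ebit (x y : Fin 2 × Fin 2) :
    entry ebit x y = (if x.1 = x.2 then 1 else 0) * (if y.1 = y.2 then 1 else 0) / 2 := by
  have hb : ∀ x : Fin 2 × Fin 2, bellVec x = ((1 / √2 : ℝ) : ℂ) * if x.1 = x.2 then 1 else 0 := by
    intro x
    change ((1 / √2 : ℝ) : ℂ) * ((ket (0, 0) : L2 (Fin 2 × Fin 2)) x +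
      (ket (1, 1) : L2 (Fin 2 × Fin 2)) x) = _
    rw [ket_apply, ket_apply]
    congr 1
    obtain ⟨i, j⟩ := x
    fin_cases i <;> fin_cases j <;> simp
  have hs : ((1 / √2 : ℝ) : ℂ) * ((1 / √2 : ℝ) : ℂ) = 1 / 2 := by
    rw [← Complex.ofReal_mul, div_mul_div_comm, Real.mul_self_sqrt (by norm_num)]
    norm_num
  rw [ebit, entry_proj, hb, hb, map_mul, Complex.conj_ofReal, mul_mul_mul_comm, hs]
  split_ifs <;> simp

theorem entry_copies_ebit (m : ℕ) (x y : Copies (Fin 2) (Fin 2) m) :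
    entry (copies ebit m) x y =
      (1 / 2) ^ m * ((if x.1 = x.2 then 1 else 0) * (if y.1 = y.2 then 1 else 0)) := by
  rw [entry_copies]
  simp only [entry_ebit, Finset.prod_div_distrib, Finset.prod_mul_distrib, Finset.prod_const,
    Finset.card_univ, Fintype.card_fin, Finset.prod_ite_zero, Finset.mem_univ, true_implies,
    one_pow, funext_iff]
  rw [one_div, inv_pow, div_eq_inv_mul]

theorem sum_mul_ite_eq {α : Type} [Fintype α] [DecidableEq α] (c : ℂ) (x x' y y' : α) :
    ∑ p : α × α, c * (((if x = p.1 then 1 else 0) * (if x' = p.1 then 1 else 0)) *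
      ((if y = p.2 then 1 else 0) * (if y' = p.2 then 1 else 0))) =
    c * ((if x = x' then 1 else 0) * (if y = y' then 1 else 0)) := by
  rw [← Finset.mul_sum, Fintype.sum_prod_type]
  simp

/-- The expansion of `m` entanglement bits `2⁻ᵐ ∑ₛₜ |s⟩⟨t| ⊗ |s⟩⟨t|` into product states, by
polarization of the factor `|s⟩⟨t|` of either party. -/
theorem copies_ebit_eq (m : ℕ) :
    copies ebit m = ∑ q : ((Fin m → Fin 2) × (Fin m → Fin 2)) × (Fin 4 × Fin 4),
      ((1 / 2 : ℂ) ^ m / 16 * (Complex.I ^ (q.2.1 : ℕ) * Complex.I ^ (q.2.2 : ℕ))) •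
        proj (tensorVec (phaseVec q.1.1 q.1.2 q.2.1) (phaseVec q.1.1 q.1.2 q.2.2)) := by
  refine ext_entry fun x y => ?_
  have he : ∀ (c : ((Fin m → Fin 2) × (Fin m → Fin 2)) × (Fin 4 × Fin 4) → ℂ) (ψ : _ → L2 _),
      entry (∑ q, c q • proj (ψ q)) x y = ∑ q, c q * (ψ q x * conj (ψ q y)) := fun c ψ => by
    simp only [← entry_proj, ← entry_smul]
    simp [entry]
  rw [he, entry_copies_ebit, Fintype.sum_prod_type]
  have h1 : ∀ p : (Fin m → Fin 2) × (Fin m → Fin 2), (∑ q : Fin 4 × Fin 4,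
      (1 / 2 : ℂ) ^ m / 16 * (Complex.I ^ (q.1 : ℕ) * Complex.I ^ (q.2 : ℕ)) *
        (tensorVec (phaseVec p.1 p.2 q.1) (phaseVec p.1 p.2 q.2) x *
          conj (tensorVec (phaseVec p.1 p.2 q.1) (phaseVec p.1 p.2 q.2) y))) =
      (1 / 2) ^ m * (((if x.1 = p.1 then 1 else 0) * (if x.2 = p.1 then 1 else 0)) *
        ((if y.1 = p.2 then 1 else 0) * (if y.2 = p.2 then 1 else 0))) := fun p => by
    rw [mul_mul_mul_comm (if x.1 = p.1 then (1 : ℂ) else 0)]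
    refine Eq.trans (Finset.sum_congr rfl fun q _ => ?_)
      (sum_phases_mul ((1 / 2 : ℂ) ^ m) (sum_phaseVec p.1 p.2 x.1 y.1)
        (sum_phaseVec p.1 p.2 x.2 y.2))
    rw [tensorVec_apply, tensorVec_apply, map_mul]
  refine Eq.trans ?_ (Finset.sum_congr rfl fun p _ => (h1 p).symm)
  exact (sum_mul_ite_eq _ _ _ _ _).symm

/-- There are `16 * 4 ^ m` product terms with coefficients of modulus `2⁻ᵐ / 16`, and each of the
product vectors has norm at most `4`. -/
theorem BoundedOnProducts.norm_trace_copies_ebit_le {K : ConeKind} {a b : Type} {m : ℕ}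
    {Λ : PTPMap (Copies (Fin 2) (Fin 2) m) (a × b)} (hΛ : BoundedOnProducts K Λ)
    {X : Op (a × b)} (hX : X ∈ dualInterval K a b) :
    ‖trace (X ∘L Λ.toFun (copies ebit m))‖ ≤ 16 * 2 ^ m := by
  rw [copies_ebit_eq, Λ.trace_comp_sum]
  refine (norm_sum_le_of_le (f := _) (n := fun _ => (1 / 2 : ℝ) ^ m) _ fun q _ => ?_).trans ?_
  · have h := hΛ X hX (phaseVec q.1.1 q.1.2 q.2.1) (phaseVec q.1.1 q.1.2 q.2.2)
    have h1 := norm_sq_phaseVec_le q.1.1 q.1.2 q.2.1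
    have h2 := norm_sq_phaseVec_le q.1.1 q.1.2 q.2.2
    have h3 := h.trans (mul_le_mul h1 h2 (by positivity) (by norm_num))
    rw [norm_mul]
    have h4 : ‖(1 / 2 : ℂ) ^ m / 16 * (Complex.I ^ (q.2.1 : ℕ) * Complex.I ^ (q.2.2 : ℕ))‖ =
        (1 / 2 : ℝ) ^ m / 16 := by simp
    rw [h4]
    calc _ ≤ (1 / 2 : ℝ) ^ m / 16 * (4 * 4) := by gcongr
      _ = _ := by ring
  · rw [Finset.sum_const, Finset.card_univ, nsmul_eq_mul]
    simp only [Fintype.card_prod, Fintype.card_pi, Fintype.card_fin, Finset.prod_const,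
      Finset.card_univ]
    push_cast
    apply le_of_eq
    rw [one_div, inv_pow]
    field_simp

/-! ### The tempered negativity and the tempered robustness -/

theorem IsState.nonempty {ι : Type} {ρ : Op ι} (hρ : IsState ρ) : Nonempty ι := by
  by_contra h
  rw [not_nonempty_iff] at h
  have := hρ.trace_eq_one
  rw [trace, tsum_empty] at this
  exact zero_ne_one this

theorem isSelfAdjoint_of_isPartialTranspose {a b : Type} {X Y : Op (a × b)}
    (h : IsPartialTranspose X Y) (hX : IsSelfAdjoint X) : IsSelfAdjoint Y := by
  rw [isSelfAdjoint_iff_entry] at hX ⊢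
  rintro ⟨i, j⟩ ⟨i', j'⟩
  rw [h, h, hX]

theorem temperedNegativity_eq_negativitySDP {a b : Type} {ρ : Op (a × b)} (hρ : IsState ρ) :
    temperedNegativity ρ ρ = negativitySDP ρ := by
  have hset : {X : Op (a × b) | IsSelfAdjoint X ∧ (∃ Y, IsPartialTranspose X Y ∧ ‖Y‖ ≤ 1) ∧
      ‖X‖ = (trace (X ∘L ρ)).re} = {X : Op (a × b) | IsSelfAdjoint X ∧
      (∃ Y, IsSelfAdjoint Y ∧ IsPartialTranspose X Y ∧ -1 ≤ Y ∧ Y ≤ 1) ∧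
      -((trace (X ∘L ρ)).re • (1 : Op (a × b))) ≤ X ∧
        X ≤ (trace (X ∘L ρ)).re • (1 : Op (a × b))} := by
    ext X
    refine and_congr_right fun hX => and_congr ?_ ?_
    · refine exists_congr fun Y => ?_
      constructor
      · rintro ⟨h1, h2⟩
        have hY := isSelfAdjoint_of_isPartialTranspose h1 hX
        exact ⟨hY, h1, (norm_le_one_iff_of_isSelfAdjoint hY).1 h2⟩
      · rintro ⟨hY, h1, h3⟩
        exact ⟨h1, (norm_le_one_iff_of_isSelfAdjoint hY).2 h3⟩
    · have hle : (trace (X ∘L ρ)).re ≤ ‖X‖ :=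
        (Complex.re_le_norm _).trans (hρ.norm_trace_comp_le X)
      constructor
      · intro h
        exact (norm_le_iff_of_isSelfAdjoint hX (h ▸ norm_nonneg X)).1 h.le
      · intro h
        refine le_antisymm ((norm_le_iff_of_isSelfAdjoint hX ?_).2 h) hle
        -- `-c ≤ X ≤ c` is impossible for `c < 0`, as the space is not zero.
        obtain ⟨x⟩ := hρ.nonempty
        have h1 := entry_diag_nonneg (sub_nonneg.2 (h.1.trans h.2)) x
        have h2 : entry (1 : Op (a × b)) x x = 1 := by
          classical
          rw [entry_eq]
          exact (ket_apply x x).trans (if_pos rfl)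
        rw [sub_neg_eq_add, entry_add, entry_real_smul, h2, mul_one, ← Complex.ofReal_add] at h1
        have := Complex.zero_le_real.1 h1
        linarith
  rw [temperedNegativity, negativitySDP, hset]

/-- Tensor powers of the feasible points of `N_τ(ρ)` are feasible for the tempered robustness of
`ρ^{⊗n}`: all quantities involved are multiplicative. -/
theorem ofReal_pow_le_temperedBaseNorm (K : ConeKind) {a b : Type} {ρ X Y : Op (a × b)}
    (hρ : IsState ρ) (hX : IsSelfAdjoint X) (hXY : IsPartialTranspose X Y) (hY : ‖Y‖ ≤ 1)
    (hXρ : ‖X‖ = (trace (X ∘L ρ)).re) (n : ℕ) :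
    ENNReal.ofReal (‖X‖ ^ n) ≤ temperedBaseNorm K (copies ρ n) (copies ρ n) := by
  have htr : trace (X ∘L ρ) = (‖X‖ : ℂ) := by
    have h1 := hρ.norm_trace_comp_le X
    rw [hXρ] at h1 ⊢
    exact Complex.eq_re_of_ofReal_le (Complex.re_eq_norm.1 (le_antisymm (Complex.re_le_norm _) h1))
  have hpow : (trace (copies X n ∘L copies ρ n)).re = ‖X‖ ^ n := by
    rw [hρ.trace_comp_copies, htr, ← Complex.ofReal_pow, Complex.ofReal_re]
  have hfeas : copies X n ∈ {Z | Z ∈ dualInterval K (Fin n → a) (Fin n → b) ∧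
      ‖Z‖ = (trace (Z ∘L copies ρ n)).re} := by
    refine ⟨mem_dualInterval_of_isPartialTranspose K (isSelfAdjoint_copies hX n)
      (isPartialTranspose_copies hXY n)
      ((norm_copies_le Y n).trans (pow_le_one₀ (norm_nonneg _) hY)), ?_⟩
    refine le_antisymm ((norm_copies_le X n).trans hpow.ge) ?_
    exact (Complex.re_le_norm _).trans ((isState_copies hρ n).norm_trace_comp_le _)
  rw [← hpow]
  exact le_iSup₂ (f := fun (Z : Op (Copies a b n)) (_ : Z ∈ {Z | Z ∈
    dualInterval K (Fin n → a) (Fin n → b) ∧ ‖Z‖ = (trace (Z ∘L copies ρ n)).re}) =>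
      ENNReal.ofReal (trace (Z ∘L copies ρ n)).re) _ hfeas

theorem half_le_one_add_temperedRobustness (K : ConeKind) {a b : Type} (ρ : Op (a × b)) :
    temperedBaseNorm K ρ ρ / 2 ≤ 1 + temperedRobustness K ρ := by
  rw [temperedRobustness]
  calc temperedBaseNorm K ρ ρ / 2 ≤ (1 + (temperedBaseNorm K ρ ρ - 1)) / 2 := by
        gcongr
        exact le_add_tsub
    _ = 1 / 2 + (temperedBaseNorm K ρ ρ - 1) / 2 := ENNReal.add_div
    _ ≤ _ := by
        gcongr
        simp

theorem one_add_temperedRobustness_le (K : ConeKind) {a b : Type} (ρ : Op (a × b)) :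
    1 + temperedRobustness K ρ ≤ 1 + temperedBaseNorm K ρ ρ := by
  gcongr
  exact (ENNReal.div_le_of_le_mul (tsub_le_self.trans (le_mul_of_one_le_right' one_le_two)))

/-! ### Base-two logarithms -/

theorem log2_mono {x y : ℝ≥0∞} (h : x ≤ y) : log2 x ≤ log2 y :=
  EReal.div_le_div_right_of_nonneg (by exact_mod_cast Real.log_nonneg one_le_two)
    (ENNReal.log_monotone h)

theorem log2_ofReal {x : ℝ} (hx : 0 < x) :
    log2 (ENNReal.ofReal x) = ((Real.log x / Real.log 2 : ℝ) : EReal) := by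
  rw [log2, ENNReal.log_ofReal_of_pos hx, EReal.coe_div]

theorem log2_le_iff {x : ℝ≥0∞} {r : EReal} :
    log2 x ≤ r ↔ x ≤ EReal.exp ((Real.log 2 : EReal) * r) := by
  rw [log2, EReal.div_le_iff_le_mul (by exact_mod_cast Real.log_pos one_lt_two)
    (EReal.coe_ne_top _), ← ENNReal.log_le_log_iff, EReal.log_exp]

theorem tendsto_add_mul_div (c r : ℝ) :
    Tendsto (fun n : ℕ => (((c + r * n) / n : ℝ) : EReal)) atTop (𝓝 (r : EReal)) := by
  refine (continuous_coe_real_ereal.tendsto r).comp ?_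
  have h : Tendsto (fun n : ℕ => c / n + r) atTop (𝓝 (0 + r)) :=
    (tendsto_const_div_atTop_nhds_zero_nat c).add_const r
  rw [zero_add] at h
  refine h.congr' ?_
  filter_upwards [eventually_gt_atTop 0] with n hn
  have : (n : ℝ) ≠ 0 := by positivity
  field_simp

theorem log2_ofReal_div {x : ℝ} (hx : 0 < x) (n : ℕ) :
    log2 (ENNReal.ofReal x) / (n : EReal) = ((Real.log x / Real.log 2 / n : ℝ) : EReal) := by
  rw [log2_ofReal hx, EReal.coe_div _ (n : ℝ)]
  rfl

theorem temperedLogNegativity_le_regTemperedRobustness (K : ConeKind) {a b : Type}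
    {ρ : Op (a × b)} (hρ : IsState ρ) :
    temperedLogNegativity ρ ≤ regTemperedRobustness K ρ := by
  rw [temperedLogNegativity, log2_le_iff]
  refine iSup₂_le fun X hX => ?_
  obtain ⟨hXsa, ⟨Y, hXY, hY⟩, hXρ⟩ := hX
  rw [← hXρ, ← log2_le_iff]
  rcases (norm_nonneg X).eq_or_lt with h0 | hpos
  · rw [← h0]
    simp [log2_le_iff]
  have hlim := tendsto_add_mul_div (-1) (Real.log ‖X‖ / Real.log 2)
  rw [log2_ofReal hpos, ← hlim.limsup_eq]
  refine limsup_le_limsup (Eventually.of_forall fun n => ?_)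
  have h1 : ENNReal.ofReal (‖X‖ ^ n / 2) ≤ 1 + temperedRobustness K (copies ρ n) := by
    refine le_trans ?_ (half_le_one_add_temperedRobustness K _)
    rw [ENNReal.ofReal_div_of_pos two_pos, ENNReal.ofReal_ofNat]
    gcongr
    exact ofReal_pow_le_temperedBaseNorm K hρ hXsa hXY hY hXρ n
  refine le_trans (le_of_eq ?_) (EReal.div_le_div_right_of_nonneg (by positivity) (log2_mono h1))
  rw [log2_ofReal_div (by positivity), Real.log_div (by positivity) two_ne_zero, Real.log_pow]
  have : Real.log 2 ≠ 0 := (Real.log_pos one_lt_two).ne'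
  rw [EReal.coe_eq_coe_iff]
  congr 1
  field_simp
  ring

/-! ### Lower bounds on the cost -/

/-- Suppose that an operation that is bounded on products turns `m` entanglement bits into a state
at trace distance less than `ε < 1/2` from `σ`. The constraint `‖X‖ = Tr X σ` then bounds the
resulting error in `Tr X σ` by `2 ε Tr X σ`, which is absorbed on the left-hand side. -/
theorem temperedBaseNorm_le_of_approx {K : ConeKind} {a b : Type} {m : ℕ}
    {Λ : PTPMap (Copies (Fin 2) (Fin 2) m) (a × b)} (hΛ : BoundedOnProducts K Λ)
    {σ : Op (a × b)} (hσ : IsState σ) {ε : ℝ} (hε : ε < 1 / 2)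
    (hle : traceNorm (Λ.toFun (copies ebit m) - σ) / 2 < ENNReal.ofReal ε) :
    temperedBaseNorm K σ σ ≤ ENNReal.ofReal (16 * 2 ^ m / (1 - 2 * ε)) := by
  refine iSup₂_le fun X hX => ENNReal.ofReal_le_ofReal ?_
  obtain ⟨hXK, hXσ⟩ := hX
  have hebit : 0 ≤ copies ebit m := copies_nonneg (proj_nonneg _) m
  set τ := Λ.toFun (copies ebit m) with hτ
  have hτ0 : 0 ≤ τ := Λ.nonneg _ (isTraceClass_of_finite _) hebit
  have hε0 : 0 < ε := ENNReal.ofReal_pos.1 (pos_of_gt hle)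
  have hlt : traceNorm (τ - σ) < ENNReal.ofReal (2 * ε) := by
    rw [ENNReal.div_lt_iff (by simp) (by simp)] at hle
    rwa [mul_comm, ENNReal.ofReal_mul hε0.le, ENNReal.ofReal_ofNat]
  have htc : IsTraceClass (τ - σ) := hlt.trans ENNReal.ofReal_lt_top
  have hsa : IsSelfAdjoint (τ - σ) :=
    (IsSelfAdjoint.of_nonneg hτ0).sub (IsSelfAdjoint.of_nonneg hσ.nonneg)
  obtain ⟨v, hv⟩ := (Λ.traceClass _ (isTraceClass_of_finite _)).exists_isEnsemble hτ0
  obtain ⟨w, hw⟩ := hσ.traceClass.exists_isEnsemble hσ.nonneg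
  have h1 := norm_trace_comp_le htc hsa X
  rw [ContinuousLinearMap.comp_sub, trace_sub (hv.summable_entry_comp X)
    (hw.summable_entry_comp X)] at h1
  have h2 := hΛ.norm_trace_copies_ebit_le hXK
  have h3 := (abs_le.1 ((Complex.abs_re_le_norm _).trans h1)).1
  have h4 := (Complex.re_le_norm _).trans h2
  have h5 : ‖X‖ * (traceNorm (τ - σ)).toReal ≤ ‖X‖ * (2 * ε) :=
    mul_le_mul_of_nonneg_left ((ENNReal.lt_ofReal_iff_toReal_lt hlt.ne_top).1 hlt).le
      (norm_nonneg X)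
  rw [Complex.sub_re, ← hXσ] at h3
  rw [← hXσ, le_div_iff₀ (by linarith)]
  linarith

/-- The regularized tempered robustness bounds the cost under all classes of operations that are
bounded on products, at any error threshold below `1/2`. -/
theorem regTemperedRobustness_le_cost {K : ConeKind} {a b : Type} {ρ : Op (a × b)}
    (hρ : IsState ρ) {F : (m n : ℕ) → Set (PTPMap (Copies (Fin 2) (Fin 2) m) (Copies a b n))}
    (hF : ∀ m n, ∀ Λ ∈ F m n, BoundedOnProducts K Λ) {ε : ℝ} (hε0 : 0 ≤ ε) (hε : ε < 1 / 2) :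
    regTemperedRobustness K ρ ≤ cost F ε ρ := by
  refine le_sInf ?_
  rintro _ ⟨R, rfl, hR, hlim⟩
  obtain ⟨δ, hδ, hδ2⟩ := exists_between hε
  have hδ0 : 0 < δ := hε0.trans_lt hδ
  have hpos : 0 < 1 - 2 * δ := by linarith
  -- `C * 2 ^ (R * n)` dominates `1 + 16 * 2 ^ ⌊R * n⌋₊ / (1 - 2 * δ)`.
  set C : ℝ := 1 + 16 / (1 - 2 * δ) with hC
  have hCpos : 0 < C := by positivity
  have hev := eventually_lt_of_limsup_lt
    (hlim.trans_lt ((ENNReal.ofReal_lt_ofReal_iff hδ0).2 hδ))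
  have hbound : ∀ᶠ n : ℕ in atTop, log2 (1 + temperedRobustness K (copies ρ n)) / (n : EReal) ≤
      (((Real.log C / Real.log 2 + R * n) / n : ℝ) : EReal) := by
    filter_upwards [hev] with n hn
    obtain ⟨Λ, hΛ⟩ := iInf_lt_iff.1 hn
    obtain ⟨hΛF, hΛ⟩ := iInf_lt_iff.1 hΛ
    have h1 := temperedBaseNorm_le_of_approx (hF _ _ Λ hΛF) (isState_copies hρ n) hδ2 hΛ
    have hfloor : (2 : ℝ) ^ ⌊R * n⌋₊ ≤ 2 ^ (R * n) := by
      rw [← Real.rpow_natCast]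
      exact Real.rpow_le_rpow_of_exponent_le one_le_two (Nat.floor_le (by positivity))
    have hone : (1 : ℝ) ≤ 2 ^ (R * n) := Real.one_le_rpow one_le_two (by positivity)
    have h2 : 1 + temperedRobustness K (copies ρ n) ≤ ENNReal.ofReal (C * 2 ^ (R * n)) := by
      refine (one_add_temperedRobustness_le K _).trans ((add_le_add_right h1 1).trans ?_)
      rw [← ENNReal.ofReal_one, ← ENNReal.ofReal_add zero_le_one (by positivity)]
      refine ENNReal.ofReal_le_ofReal ?_
      rw [hC, add_mul, one_mul, div_mul_eq_mul_div]
      gcongr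
    refine (EReal.div_le_div_right_of_nonneg (by positivity) (log2_mono h2)).trans (le_of_eq ?_)
    rw [log2_ofReal_div (by positivity), Real.log_mul hCpos.ne' (by positivity),
      Real.log_rpow two_pos, add_div _ _ (Real.log 2),
      mul_div_cancel_right₀ _ (Real.log_pos one_lt_two).ne']
  exact (limsup_le_limsup hbound).trans (tendsto_add_mul_div _ _).limsup_eq.le

end Ent

theorem theoremS1 {a b : Type} [Countable a] [Countable b] (ρ : Ent.Op (a × b))
    (hρ : Ent.IsState ρ) :
    (∀ K : Ent.ConeKind,
      Ent.regTemperedRobustness K ρ ≤ (⨅ ε ∈ Set.Ico (0 : ℝ) (1 / 2), Ent.costKP K ε ρ) ∧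
      Ent.temperedLogNegativity ρ ≤ Ent.regTemperedRobustness K ρ) ∧
    Ent.temperedLogNegativity ρ ≤ Ent.costLOCC ρ ∧
    Ent.temperedNegativity ρ ρ = Ent.negativitySDP ρ := by
  refine ⟨fun K => ⟨le_iInf₂ fun ε hε => ?_,
    Ent.temperedLogNegativity_le_regTemperedRobustness K hρ⟩, ?_,
    Ent.temperedNegativity_eq_negativitySDP hρ⟩
  · exact Ent.regTemperedRobustness_le_cost hρ
      (fun m n Λ hΛ => Ent.boundedOnProducts_of_mem_preserving hΛ) hε.1 hε.2
  · obtain ⟨i, j⟩ := hρ.nonempty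
    have : Nonempty a := ⟨i⟩
    have : Nonempty b := ⟨j⟩
    exact (Ent.temperedLogNegativity_le_regTemperedRobustness .sep hρ).trans
      (Ent.regTemperedRobustness_le_cost hρ
        (fun m n Λ hΛ => Ent.boundedOnProducts_of_mem_locc hΛ) le_rfl (by norm_num))
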